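/- Let $\Lambda$ be a finite set, let $F_i$ ($i\in\Lambda$) be finite totally ordered sets, and let $P$ be a probability on $\Omega=\prod_{i\in\Lambda}F_i$; write $\Omega_M=\prod_{i\in M}F_i$. *Foldings.* Let $Q$ be a probability on $\Omega_M$, $K\subseteq M$, $\alpha\in\Omega_K$, and $\beta(1),\beta(2)\in\Omega_{M\setminus K}$ with $\beta_i(1)\ne\beta_i(2)$ for all $i$. The folding $Q^{K,\alpha,\beta}$ is the probability on $\Omega_{M\setminus K}$ with $$Q^{K,\alpha,\beta}(\omega)=\frac1Z\,Q(\alpha\omega)\,Q(\alpha\overline{\omega})\quad\text{if }\omega_i\in\{\beta_i(1),\beta_i(2)\}\text{ for all } i,$$ and $0$ otherwise, where $\alpha\omega$ is the concatenation and $\overline\omega$ is obtained from $\omega$ by exchanging $\beta_i(1)$ and $\beta_i(2)$ at every site; it is defined if this weight is non-zero for some $\omega$. After a first folding of $P$ the sets $\{\beta_i(1),\beta_i(2)\}$ are relabelled, preserving the order, as $\{0,1\}$; $\beta$ is irrelevant in all later foldings. An infinite branch of the essential tree of foldings of $P$ is an infinite sequence of successive (defined) foldings starting from $P$, with sets $K_0,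 K_1,K_2,\dots$, each $K_n$ contained in the set of sites not yet removed, such that for some $L\ge 0$ one has $K_n\neq\emptyset$ for $1\le n\le L$ and $K_n=\emptyset$ for $n>L$. Its limiting distribution $P^\infty$ is the pointwise limit of the iterated foldings, a probability on $\{0,1\}^M$, where $M=\Lambda\setminus(K_0\cup\dots\cup K_L)$. *RCR.* Let $\mathcal B$ be a family of subsets of $\Lambda$ and $\mathcal B_M=\{b\cap M: b\in\mathcal B\}$. A $\mathcal B$-RCR of a probability $Q$ on $\{0,1\}^M$ is a probability $\nu$ on $\prod_{b\in\mathcal B_M}\mathcal P(\{0,1\}^b)$ such that, for a constant $Z>0$, $$Q(\omega)=\frac1Z\sum_{\eta:\ \omega_b\in\eta_b\ \forall b\in\mathcal B_M}\nu(\eta)\qquad\text{for all }\omega\in\{0,1\}^M .$$ It is antiferromagnetic if, with $\nu$-probability one, each $\eta_b$ is either $\{0,1\}^b$ or the set of non-constant configurations on $b$ (which is $\{(0,1),(1,0)\}$ when $|b|=2$); symmetric if, with $\nu$-probability one, each $\eta_b$ is closed under the exchange of $0$ and $1$ at all sites of $b$; concentrated on isolated edges if $|b|\le 2$ for all $b\in\mathcal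 B_M$ and, with $\nu$-probability one, any two distinct $b,b'\in\mathcal B_M$ with $\eta_b\ne\{0,1\}^b$ and $\eta_{b'}\neq\{0,1\}^{b'}$ are disjoint. **Theorem.** Suppose that for some $\mathcal B$ the limiting distribution of every infinite branch of the essential tree of foldings of $P$ has a $\mathcal B$-RCR which is antiferromagnetic, symmetric and concentrated on isolated edges. Then $P$ is negatively associated: $P(A\cap B)\le P(A)P(B)$ for all increasing events $A,B\subseteq\Omega$ with disjoint support, i.e. such that there is $N\subseteq\Lambda$ such that, for all $\omega\in A\cap B$, every $\omega'$ which agrees with $\omega$ on $N$ is in $A$ and every $\omega'$ which agrees with $\omega$ on $\Lambda\setminus N$ is in $B$. -/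

import Mathlib

open Filter Topology

namespace FoldRCR

/-! ### Finite probability spaces -/

/-- `p` is (the mass function of) a probability on the finite set `X`. -/
structure IsProb {X : Type*} [Fintype X] (p : X → ℝ) : Prop where
  nonneg : ∀ x, 0 ≤ p x
  sum_eq_one : ∑ x, p x = 1

/-- The probability of an event. -/
noncomputable def prob {X : Type*} [Fintype X] (p : X → ℝ) (A : Set X) : ℝ :=
  ∑ x, A.indicator p x

/-! ### Generalized random cluster representations

`ι` is the finite set of sites, `F i` the finite set of symbols at `i`, and a hyperbond is a
`b : Finset ι`. -/

/-- The set `H = ∏_{b ∈ 𝓑} 𝓟(Ω_b)` of hyperbond configurations. -/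
abbrev BondConf {ι : Type*} (F : ι → Type*) (B : Finset (Finset ι)) : Type _ :=
  ∀ b : {b // b ∈ B}, Finset (∀ i : {i // i ∈ b.1}, F i.1)

/-- Compatibility `η ∼ ω`: the restriction `ω_b` belongs to `η_b` for every hyperbond `b`. -/
def Compat {ι : Type*} {F : ι → Type*} {B : Finset (Finset ι)}
    (η : BondConf F B) (ω : ∀ i, F i) : Prop :=
  ∀ b : {b // b ∈ B}, (fun i : {i // i ∈ b.1} => ω i.1) ∈ η b

/-- `ν` is a `𝓑`-RCR of `P`: it is a probability on `H` and
`P(ω) = Z⁻¹ ∑_{η ∼ ω} ν(η)` for all `ω`. -/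
def IsRCR {ι : Type*} [Fintype ι] [DecidableEq ι] {F : ι → Type*} [∀ i, Fintype (F i)]
    [∀ i, DecidableEq (F i)] (B : Finset (Finset ι)) (P : (∀ i, F i) → ℝ)
    (ν : BondConf F B → ℝ) : Prop :=
  IsProb ν ∧ ∃ Z : ℝ, 0 < Z ∧
    ∀ ω : ∀ i, F i, P ω = (1 / Z) * ∑ η : BondConf F B, {η | Compat η ω}.indicator ν η

/-- Hyperbond configurations over the binary alphabet (`true` is `1`, `false` is `0`). -/
abbrev BinBondConf {ι : Type*} (B : Finset (Finset ι)) : Type _ :=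
  BondConf (fun _ : ι => Bool) B

/-- `ν` is symmetric: `ω_b ∈ η_b` implies that the reversed configuration is in `η_b`
(with `ν`-probability one). -/
def IsSymmetric {ι : Type*} {B : Finset (Finset ι)} (ν : BinBondConf B → ℝ) : Prop :=
  ∀ η, ν η ≠ 0 → ∀ b : {b // b ∈ B}, ∀ ω ∈ η b, (fun i => !(ω i)) ∈ η b

/-- The non-constant binary configurations on `b`; for `|b| = 2` this is `{(0,1), (1,0)}`. -/
def antiSet {ι : Type*} [DecidableEq ι] (b : Finset ι) : Finset ({i // i ∈ b} → Bool) :=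
  Finset.univ.filter fun ω => ∃ i j, ω i ≠ ω j

/-- `ν` is antiferromagnetic: with `ν`-probability one, each `η_b` is either
`{(0,1), (1,0)}` or `Ω_b`. -/
def IsAntiferromagnetic {ι : Type*} [DecidableEq ι] {B : Finset (Finset ι)}
    (ν : BinBondConf B → ℝ) : Prop :=
  ∀ η, ν η ≠ 0 → ∀ b : {b // b ∈ B}, η b = antiSet b.1 ∨ η b = Finset.univ

/-- `ν` is concentrated on isolated edges: hyperbonds have at most two elements and, with
`ν`-probability one, distinct active hyperbonds (those with `η_b ≠ Ω_b`) are disjoint. -/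
def OnIsolatedEdges {ι : Type*} [DecidableEq ι] {B : Finset (Finset ι)}
    (ν : BinBondConf B → ℝ) : Prop :=
  (∀ b ∈ B, b.card ≤ 2) ∧
    ∀ η, ν η ≠ 0 → ∀ b c : {b // b ∈ B}, b ≠ c → η b ≠ Finset.univ → η c ≠ Finset.univ →
      Disjoint b.1 c.1

/-! ### Foldings -/

/-- `Ω_M = ∏_{i ∈ M} F_i`. -/
abbrev Conf {Λ : Type*} (F : Λ → Type*) (M : Finset Λ) : Type _ :=
  ∀ i : {i // i ∈ M}, F i.1

/-- Binary configurations `{0,1}^M`. -/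
abbrev BinConf {Λ : Type*} (M : Finset Λ) : Type _ := Conf (fun _ : Λ => Bool) M

/-- Concatenation of a configuration on `K` and one on `M \ K`. -/
def concat {Λ : Type*} [DecidableEq Λ] {F : Λ → Type*} {M K : Finset Λ}
    (α : Conf F K) (ω : Conf F (M \ K)) : Conf F M := fun i =>
  if h : i.1 ∈ K then α ⟨i.1, h⟩ else ω ⟨i.1, Finset.mem_sdiff.2 ⟨i.2, h⟩⟩

/-- The reverse configuration: `β₁(i)` and `β₂(i)` are exchanged at every site. -/
def reverse {Λ : Type*} {F : Λ → Type*} [∀ i, DecidableEq (F i)] {M : Finset Λ}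
    (β₁ β₂ ω : Conf F M) : Conf F M := fun i =>
  if ω i = β₁ i then β₂ i else if ω i = β₂ i then β₁ i else ω i

/-- The unnormalized folding: `P(α ω) P(α ω̄)` if `ω_i ∈ {β₁(i), β₂(i)}` for all `i`,
and `0` otherwise. -/
def foldWeight {Λ : Type*} [DecidableEq Λ] {F : Λ → Type*} [∀ i, DecidableEq (F i)]
    {M : Finset Λ} (P : Conf F M → ℝ) (K : Finset Λ) (α : Conf F K)
    (β₁ β₂ : Conf F (M \ K)) (ω : Conf F (M \ K)) : ℝ :=
  if ∀ i, ω i = β₁ i ∨ ω i = β₂ i then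
    P (concat α ω) * P (concat α (reverse β₁ β₂ ω))
  else 0

/-- The folding `P^{K, α, β}` on `Ω_{M \ K}` of a probability `P` on `Ω_M`. -/
noncomputable def fold {Λ : Type*} [DecidableEq Λ] {F : Λ → Type*} [∀ i, DecidableEq (F i)]
    [∀ i, Fintype (F i)] {M : Finset Λ} (P : Conf F M → ℝ) (K : Finset Λ) (α : Conf F K)
    (β₁ β₂ : Conf F (M \ K)) (ω : Conf F (M \ K)) : ℝ :=
  foldWeight P K α β₁ β₂ ω / ∑ ω', foldWeight P K α β₁ β₂ ω'

/-- The order preserving relabelling of `{β₁(i), β₂(i)}` by `{0,1}`: the configuration that a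
binary configuration stands for. -/
def relabel {Λ : Type*} {F : Λ → Type*} [∀ i, LinearOrder (F i)] {M : Finset Λ}
    (β₁ β₂ : Conf F M) (ξ : BinConf M) : Conf F M := fun i =>
  if ξ i = true then max (β₁ i) (β₂ i) else min (β₁ i) (β₂ i)

/-! ### The tree of foldings -/

/-- The data of an infinite sequence of foldings: the sets `K_0, K_1, …`, the configurations on
them, and the pair `(β₁, β₂)` of the first folding. After the first folding
the alphabet is binary. -/
structure FoldSeq {Λ : Type*} [Fintype Λ] [DecidableEq Λ] (F : Λ → Type*) where
  K : ℕ → Finset Λ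
  α₀ : Conf F (K 0)
  α : ∀ n : ℕ, BinConf (K (n + 1))
  β₁ : Conf F (Finset.univ \ K 0)
  β₂ : Conf F (Finset.univ \ K 0)

namespace FoldSeq

/-- The sites `(K_0 ∪ … ∪ K_n)ᶜ` that are left after the foldings `0, …, n`. -/
def rest {Λ : Type*} [Fintype Λ] [DecidableEq Λ] {F : Λ → Type*} (s : FoldSeq F) :
    ℕ → Finset Λ
  | 0 => Finset.univ \ s.K 0
  | n + 1 => s.rest n \ s.K (n + 1)

theorem rest_add_subset {Λ : Type*} [Fintype Λ] [DecidableEq Λ] {F : Λ → Type*}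
    (s : FoldSeq F) (L m : ℕ) : s.rest (L + m) ⊆ s.rest L := by
  induction m with
  | zero => exact Finset.Subset.refl _
  | succ m ih => exact Finset.sdiff_subset.trans ih

/-- The iterated folding of `P` after the foldings `0, …, n`, as a function on
`{0,1}^(rest n)`. -/
noncomputable def node {Λ : Type*} [Fintype Λ] [DecidableEq Λ] {F : Λ → Type*}
    [∀ i, Fintype (F i)] [∀ i, LinearOrder (F i)] (s : FoldSeq F) (P : (∀ i, F i) → ℝ) :
    (n : ℕ) → BinConf (s.rest n) → ℝ
  | 0 => fun ξ =>
      fold (M := Finset.univ) (fun ω => P fun i => ω ⟨i, Finset.mem_univ i⟩)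
        (s.K 0) s.α₀ s.β₁ s.β₂ (relabel s.β₁ s.β₂ ξ)
  | n + 1 => fold (s.node P n) (s.K (n + 1)) (s.α n) (fun _ => false) (fun _ => true)

/-- `s` is an infinite branch of the tree of foldings of `P`: `β₁`, `β₂` are pointwise different,
each `K_{n+1}` consists of sites left so far, and every folding is defined (some configuration
has non-zero weight). -/
structure IsBranch {Λ : Type*} [Fintype Λ] [DecidableEq Λ] {F : Λ → Type*}
    [∀ i, Fintype (F i)] [∀ i, LinearOrder (F i)] (s : FoldSeq F) (P : (∀ i, F i) → ℝ) :
    Prop where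
  beta_ne : ∀ i, s.β₁ i ≠ s.β₂ i
  subset : ∀ n, s.K (n + 1) ⊆ s.rest n
  defined_zero : ∃ ω, foldWeight (M := Finset.univ)
    (fun ω => P fun i => ω ⟨i, Finset.mem_univ i⟩) (s.K 0) s.α₀ s.β₁ s.β₂ ω ≠ 0
  defined_succ : ∀ n, ∃ ω, foldWeight (s.node P n) (s.K (n + 1)) (s.α n)
    (fun _ => false) (fun _ => true) ω ≠ 0

/-- The branch belongs to the essential tree: after the first folding there are `L` foldings with
non-empty `K`, and all the later ones have empty `K`. -/
def EssentialUpTo {Λ : Type*} [Fintype Λ] [DecidableEq Λ] {F : Λ → Type*} (s : FoldSeq F)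
    (L : ℕ) : Prop :=
  (∀ n, n < L → (s.K (n + 1)).Nonempty) ∧ ∀ n, L ≤ n → s.K (n + 1) = ∅

/-- `Q`, on `{0,1}^(rest L)`, is the limiting distribution of the branch (where no site is removed
after the folding `L`, so that `rest (L + m) = rest L`). -/
def IsLimit {Λ : Type*} [Fintype Λ] [DecidableEq Λ] {F : Λ → Type*}
    [∀ i, Fintype (F i)] [∀ i, LinearOrder (F i)] (s : FoldSeq F) (P : (∀ i, F i) → ℝ)
    (L : ℕ) (Q : BinConf (s.rest L) → ℝ) : Prop :=
  ∀ ω : BinConf (s.rest L),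
    Tendsto (fun m => s.node P (L + m) fun i => ω ⟨i.1, s.rest_add_subset L m i.2⟩) atTop
      (𝓝 (Q ω))

end FoldSeq

/-- The family `{b ∩ M : b ∈ 𝓑}` of hyperbonds induced on `M`. -/
def trace {Λ : Type*} [DecidableEq Λ] (B : Finset (Finset Λ)) (M : Finset Λ) :
    Finset (Finset {i // i ∈ M}) :=
  B.image fun b => b.subtype (· ∈ M)

/-- `P` has a `𝓑`-RCR at infinity with the property `C`: in every infinite branch of the essential
tree of foldings, the limiting distribution has a `𝓑`-RCR with the property `C`. -/
def HasRCRAtInfinity {Λ : Type*} [Fintype Λ] [DecidableEq Λ] {F : Λ → Type*}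
    [∀ i, Fintype (F i)] [∀ i, LinearOrder (F i)] (B : Finset (Finset Λ))
    (P : (∀ i, F i) → ℝ) (C : ∀ M : Finset Λ, (BinBondConf (trace B M) → ℝ) → Prop) : Prop :=
  ∀ (s : FoldSeq F) (L : ℕ), s.IsBranch P → s.EssentialUpTo L →
    ∀ Q : BinConf (s.rest L) → ℝ, s.IsLimit P L Q →
      ∃ ν : BinBondConf (trace B (s.rest L)) → ℝ,
        IsRCR (F := fun _ => Bool) (trace B (s.rest L)) Q ν ∧ C (s.rest L) ν

/-! ### Negative association -/

/-- The cylinder `[ω]_N`. -/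
def cylinder {Λ : Type*} {F : Λ → Type*} (ω : ∀ i, F i) (N : Set Λ) : Set (∀ i, F i) :=
  {ω' | ∀ i ∈ N, ω' i = ω i}

/-- `A` and `B` have disjoint support. -/
def DisjointSupport {Λ : Type*} {F : Λ → Type*} (A B : Set (∀ i, F i)) : Prop :=
  ∃ N : Set Λ, ∀ ω ∈ A ∩ B, cylinder ω N ⊆ A ∧ cylinder ω Nᶜ ⊆ B

/-- `P` is negatively associated. -/
def NegativelyAssociated {Λ : Type*} [Fintype Λ] [DecidableEq Λ] {F : Λ → Type*}
    [∀ i, Fintype (F i)] [∀ i, LinearOrder (F i)] (P : (∀ i, F i) → ℝ) : Prop :=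
  ∀ A B : Set (∀ i, F i), IsUpperSet A → IsUpperSet B → DisjointSupport A B →
    prob P (A ∩ B) ≤ prob P A * prob P B

end FoldRCR

namespace FoldRCR

/-! ### Correlation of functions of independent fair bits -/

/-! Duplicate the system. The covariance of `f` and `g` under `P` is half the sum of `P x * P y *
((f x - f y) * (g x - g y))` over pairs of configurations. The pairs with a given pointwise minimum
and maximum make up one folding of `P`, with `K` the set where these two agree. On such a fibre the
differences of `f` and of `g` are increasing functions of a binary configuration, odd under the
global flip (`oddMono_foldFun`). So it suffices that under every folding the product of two odd
increasing functions with disjoint supports has non-positive mean (`sum_covTerm_nonpos`).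

Duplicate again, now for a symmetric folded weight `R` and odd `f`, `g`, which have mean zero. The
fibre with `K = ∅` contributes `4 ∑ R² f g`; the others are foldings on fewer sites and contribute
at most zero by induction. This gives `(∑ R) (∑ R f g) ≤ 2 ∑ R² f g` (`sum_mul_sum_le_sum_sq`).
Since also `2 ∑ R² ≤ (∑ R)²`, a positive mean of `f g` cannot decrease when `R` is squared and
normalized, which is what a folding with `K = ∅` does. It would thus survive in the limiting
distribution (`sum_limit_pos`). The argument uses every power `R ^ 2 ^ m`, so the induction
hypothesis `NegCorrelated` has to include these powers.

The representation rules out a positive limit: given `η`, the configuration is uniform subject to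
opposite values on disjoint pairs. Each pair carries one fair bit. If `f` and `g` both depend on it,
they see different ends of the pair and are monotone in opposite directions, so a Chebyshev
inequality for independent bits applies (`sum_antithetic_nonpos`). -/

theorem two_pow_mul_sum_mul_le_fin (n : ℕ) (φ γ : (Fin n → Bool) → ℝ)
    (h : ∀ i x y, (φ (Function.update x i true) - φ (Function.update x i false)) *
      (γ (Function.update y i true) - γ (Function.update y i false)) ≤ 0) :
    2 ^ n * ∑ x, φ x * γ x ≤ (∑ x, φ x) * ∑ x, γ x := by
  induction n with
  | zero => simp
  | succ n ih =>
    have split : ∀ k : (Fin (n + 1) → Bool) → ℝ,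
        ∑ x, k x = (∑ x, k (Fin.cons true x)) + ∑ x, k (Fin.cons false x) := by
      intro k
      rw [← (Fin.consEquiv fun _ : Fin (n + 1) => Bool).sum_comp k, Fintype.sum_prod_type,
        Fintype.sum_bool]
      rfl
    have hb : ∀ a : Bool, 2 ^ n * ∑ x : Fin n → Bool, φ (Fin.cons a x) * γ (Fin.cons a x) ≤
        (∑ x : Fin n → Bool, φ (Fin.cons a x)) * ∑ x : Fin n → Bool, γ (Fin.cons a x) := by
      intro a
      refine ih (fun x => φ (Fin.cons a x)) (fun x => γ (Fin.cons a x)) fun i x y => ?_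
      simpa only [Fin.cons_update] using
        h i.succ (Fin.cons a x : Fin (n + 1) → Bool) (Fin.cons a y : Fin (n + 1) → Bool)
    -- The increments in the first bit may be taken at different `x` and `y`, so their sums also
    -- have non-positive product. This is the Chebyshev inequality for the two half-sums, which
    -- combines with the induction hypothesis on each half.
    have h0 : (∑ x : Fin n → Bool, (φ (Fin.cons true x) - φ (Fin.cons false x))) *
        ∑ x : Fin n → Bool, (γ (Fin.cons true x) - γ (Fin.cons false x)) ≤ 0 := by
      rw [Finset.sum_mul_sum]
      refine Finset.sum_nonpos fun x _ => Finset.sum_nonpos fun y _ => ?_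
      simpa only [Fin.update_cons_zero] using
        h 0 (Fin.cons true x : Fin (n + 1) → Bool) (Fin.cons true y : Fin (n + 1) → Bool)
    have ht := hb true
    have hf := hb false
    rw [Finset.sum_sub_distrib, Finset.sum_sub_distrib] at h0
    rw [split, split φ, split γ, pow_succ]
    nlinarith

theorem two_pow_mul_sum_mul_le {ι : Type*} [Fintype ι] [DecidableEq ι] (φ γ : (ι → Bool) → ℝ)
    (h : ∀ i x y, (φ (Function.update x i true) - φ (Function.update x i false)) *
      (γ (Function.update y i true) - γ (Function.update y i false)) ≤ 0) :
    2 ^ Fintype.card ι * ∑ x, φ x * γ x ≤ (∑ x, φ x) * ∑ x, γ x := by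
  have e := Fintype.equivFin ι
  have key : ∀ k : (ι → Bool) → ℝ, ∑ x : Fin (Fintype.card ι) → Bool, k (x ∘ e) = ∑ x, k x :=
    fun k => (e.symm.arrowCongr (Equiv.refl Bool)).sum_comp k
  have := two_pow_mul_sum_mul_le_fin _ (fun x => φ (x ∘ e)) (fun x => γ (x ∘ e)) fun i x y => by
    simpa only [Function.update_comp_equiv] using h (e.symm i) (x ∘ e) (y ∘ e)
  rwa [key φ, key γ, key fun x => φ x * γ x] at this

/-! ### Odd increasing functions and disjoint antithetic pairs -/

/-- `f` is increasing, odd under the exchange of `0` and `1`, and depends on the sites in `N`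
only. -/
structure OddMono {ι : Type*} (N : Set ι) (f : (ι → Bool) → ℝ) : Prop where
  mono : Monotone f
  odd : ∀ ω, f (fun i => !(ω i)) = -f ω
  dep : DependsOn f N

theorem OddMono.sum_eq_zero {ι : Type*} [Fintype ι] [DecidableEq ι] {N : Set ι}
    {f : (ι → Bool) → ℝ} (hf : OddMono N f) {X : Type*} [Fintype X] (e : X ≃ X)
    (Φ : X → ι → Bool) (hΦ : ∀ x, Φ (e x) = fun i => !(Φ x i)) : ∑ x, f (Φ x) = 0 := by
  have h : ∑ x, f (Φ (e x)) = ∑ x, f (Φ x) := e.sum_comp fun x => f (Φ x)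
  simp only [hΦ, hf.odd, Finset.sum_neg_distrib] at h
  linarith

/-- The sites in `C` carry the value opposite to that of their partners, the others are free. -/
theorem sum_antithetic_nonpos {ι : Type*} [Fintype ι] [DecidableEq ι] {N : Set ι}
    {f g : (ι → Bool) → ℝ} (hf : OddMono N f) (hg : OddMono Nᶜ g) (C : Finset ι) (p : ι → ι)
    (hp : ∀ i ∈ C, p i ∉ C) (hinj : Set.InjOn p C) :
    ∑ ω with ∀ i ∈ C, ω i ≠ ω (p i), f ω * g ω ≤ 0 := by
  -- `Φ` extends free bits on the complement of `C` to the full antithetic configuration.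
  obtain ⟨Φ, hΦC, hΦD⟩ : ∃ Φ : ({i // i ∉ C} → Bool) → ι → Bool,
      (∀ y i (h : i ∈ C), Φ y i = !(y ⟨p i, hp i h⟩)) ∧
      ∀ y i (h : i ∉ C), Φ y i = y ⟨i, h⟩ :=
    ⟨fun y i => if h : i ∈ C then !(y ⟨p i, hp i h⟩) else y ⟨i, h⟩,
      fun y i h => dif_pos h, fun y i h => dif_neg h⟩
  have hsum : ∑ ω with ∀ i ∈ C, ω i ≠ ω (p i), f ω * g ω = ∑ y, f (Φ y) * g (Φ y) := by
    symm
    refine Finset.sum_bij' (fun y _ => Φ y) (fun ω _ i => ω i.1) ?_ ?_ ?_ ?_ ?_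
    · intro y _
      simp only [Finset.mem_filter, Finset.mem_univ, true_and]
      intro i hi
      rw [hΦC y i hi, hΦD y _ (hp i hi)]
      simp
    · simp
    · intro y _
      funext i
      exact hΦD y i.1 i.2
    · intro ω hω
      simp only [Finset.mem_filter, Finset.mem_univ, true_and] at hω
      funext i
      by_cases hi : i ∈ C
      · refine (hΦC (fun i => ω i.1) i hi).trans ?_
        have := hω i hi
        revert this
        cases ω i <;> cases ω (p i) <;> simp
      · exact hΦD (fun i => ω i.1) i hi
    · intro y _
      rfl
  have hflip : ∀ y, Φ (fun i => !(y i)) = fun i => !(Φ y i) := by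
    intro y
    funext i
    by_cases hi : i ∈ C
    · exact (hΦC (fun i => !(y i)) i hi).trans (congrArg Bool.not (hΦC y i hi).symm)
    · exact (hΦD (fun i => !(y i)) i hi).trans (congrArg Bool.not (hΦD y i hi).symm)
  have hzero : ∑ y, f (Φ y) = 0 :=
    hf.sum_eq_zero ((Equiv.refl _).arrowCongr Equiv.boolNot) Φ hflip
  -- Raising the free bit `i` raises site `i` and lowers its partners in `C`. A function of the
  -- sites in `M` is hence constant, increasing or decreasing in that bit, according to which of
  -- these sites `M` contains.
  have hup : ∀ (M : Set ι) (k : (ι → Bool) → ℝ), OddMono M k → ∀ i : {i // i ∉ C},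
      ((i.1 ∉ M ∧ ∀ j ∈ C, p j = i → j ∉ M) →
        ∀ y, k (Φ (Function.update y i true)) = k (Φ (Function.update y i false))) ∧
      ((∀ j ∈ C, p j = i → j ∉ M) →
        ∀ y, k (Φ (Function.update y i false)) ≤ k (Φ (Function.update y i true))) ∧
      (i.1 ∉ M →
        ∀ y, k (Φ (Function.update y i true)) ≤ k (Φ (Function.update y i false))) := by
    intro M k hk i
    have hne : ∀ y (a b : Bool) j, j ≠ i.1 → ¬ (j ∈ C ∧ p j = i) →
        Φ (Function.update y i a) j = Φ (Function.update y i b) j := by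
      intro y a b j hj hj'
      by_cases hC : j ∈ C
      · rw [hΦC _ j hC, hΦC _ j hC, Function.update_of_ne, Function.update_of_ne] <;>
          exact fun h => hj' ⟨hC, congrArg Subtype.val h⟩
      · rw [hΦD _ j hC, hΦD _ j hC, Function.update_of_ne, Function.update_of_ne] <;>
          exact fun h => hj (congrArg Subtype.val h)
    have hi : ∀ y a, Φ (Function.update y i a) i.1 = a := by
      intro y a
      rw [hΦD _ _ i.2]
      simp
    have hj : ∀ y a j, j ∈ C → p j = i → Φ (Function.update y i a) j = !a := by
      intro y a j hC hj
      rw [hΦC _ _ hC]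
      have : (⟨p j, hp j hC⟩ : {i // i ∉ C}) = i := Subtype.ext hj
      rw [this, Function.update_self]
    refine ⟨fun h y => ?_, fun h y => ?_, fun h y => ?_⟩
    · refine hk.dep fun j hjM => hne _ _ _ _ ?_ ?_
      · rintro rfl
        exact h.1 hjM
      · exact fun hj' => h.2 j hj'.1 hj'.2 hjM
    · calc k (Φ (Function.update y i false)) =
          k (Φ (Function.update y i false) ⊓ Φ (Function.update y i true)) := by
            refine hk.dep fun j hjM => ?_
            by_cases hji : j = i.1
            · subst hji
              simp [hi]
            · rw [Pi.inf_apply, hne y false true j hji fun hj' => h j hj'.1 hj'.2 hjM, inf_idem]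
        _ ≤ _ := hk.mono inf_le_right
    · calc k (Φ (Function.update y i true)) =
          k (Φ (Function.update y i true) ⊓ Φ (Function.update y i false)) := by
            refine hk.dep fun j hjM => ?_
            by_cases hjp : j ∈ C ∧ p j = i
            · rw [Pi.inf_apply, hj y _ j hjp.1 hjp.2, hj y _ j hjp.1 hjp.2]
              rfl
            · rw [Pi.inf_apply, hne y true false j (by rintro rfl; exact h hjM) hjp, inf_idem]
        _ ≤ _ := hk.mono inf_le_right
  have main := two_pow_mul_sum_mul_le (fun y => f (Φ y)) (fun y => g (Φ y)) ?_
  · rw [hsum]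
    rw [hzero, zero_mul] at main
    by_contra hc
    exact absurd main (not_le.2 (mul_pos (by positivity) (not_le.1 hc)))
  · intro i x y
    obtain ⟨f0, f1, f2⟩ := hup N f hf i
    obtain ⟨g0, g1, g2⟩ := hup Nᶜ g hg i
    -- By injectivity of `p` there is at most one partner. If it lies on the same side of `N` as
    -- `i`, or does not exist, one of the two functions ignores the bit; otherwise they move in
    -- opposite directions.
    by_cases hiN : i.1 ∈ N
    · have hg' := g2 (fun h => h hiN) y
      by_cases hall : ∀ j ∈ C, p j = i → j ∈ N
      · rw [g0 ⟨fun h => h hiN, fun j hj hji h => h (hall j hj hji)⟩ y]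
        simp
      · push Not at hall
        obtain ⟨j, hjC, hji, hjN⟩ := hall
        have hf' := f1 (fun j' hj' hji' => by
          rwa [hinj hj' hjC (hji'.trans hji.symm)]) x
        exact mul_nonpos_of_nonneg_of_nonpos (sub_nonneg.2 hf') (sub_nonpos.2 hg')
    · have hf' := f2 hiN x
      by_cases hall : ∀ j ∈ C, p j = i → j ∉ N
      · rw [f0 ⟨hiN, hall⟩ x]
        simp
      · push Not at hall
        obtain ⟨j, hjC, hji, hjN⟩ := hall
        have hg' := g1 (fun j' hj' hji' => by
          rw [hinj hj' hjC (hji'.trans hji.symm)]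
          exact fun h => h hjN) y
        exact mul_nonpos_of_nonpos_of_nonneg (sub_nonpos.2 hf') (sub_nonneg.2 hg')

/-- Choosing an ordering of each edge turns the matching into a set `C` of first ends with a partner
map `p`; disjointness of the edges makes `p` well defined, injective and valued outside `C`. -/
theorem sum_matching_nonpos {ι : Type*} [Fintype ι] [DecidableEq ι] {N : Set ι}
    {f g : (ι → Bool) → ℝ} (hf : OddMono N f) (hg : OddMono Nᶜ g) (E : Finset (Finset ι))
    (hcard : ∀ b ∈ E, b.card = 2) (hdisj : ∀ b ∈ E, ∀ c ∈ E, b ≠ c → Disjoint b c) :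
    ∑ ω with ∀ b ∈ E, ∃ i ∈ b, ∃ j ∈ b, ω i ≠ ω j, f ω * g ω ≤ 0 := by
  have h2 : ∀ b : {b // b ∈ E}, ∃ q : ι × ι, q.1 ≠ q.2 ∧ b.1 = {q.1, q.2} := fun b => by
    obtain ⟨x, y, hxy, h⟩ := Finset.card_eq_two.1 (hcard b.1 b.2)
    exact ⟨(x, y), hxy, h⟩
  choose q hq hb using h2
  have heq : ∀ (b c : {b // b ∈ E}) i, i ∈ b.1 → i ∈ c.1 → b = c := by
    intro b c i hib hic
    by_contra hbc
    exact Finset.disjoint_left.1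
      (hdisj b.1 b.2 c.1 c.2 fun h => hbc (Subtype.ext h)) hib hic
  have m1 : ∀ b, (q b).1 ∈ b.1 := fun b => by
    have := hb b
    rw [this]
    simp
  have m2 : ∀ b, (q b).2 ∈ b.1 := fun b => by
    have := hb b
    rw [this]
    simp
  let C : Finset ι := Finset.univ.image fun b => (q b).1
  have hC : ∀ i, i ∈ C ↔ ∃ b, (q b).1 = i := by simp [C]
  classical
  let p : ι → ι := fun i => if h : ∃ b, (q b).1 = i then (q h.choose).2 else i
  have hp : ∀ b, p (q b).1 = (q b).2 := by
    intro b
    have hex : ∃ c, (q c).1 = (q b).1 := ⟨b, rfl⟩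
    have hmem := m1 hex.choose
    rw [hex.choose_spec] at hmem
    have : hex.choose = b := heq _ _ (q b).1 hmem (m1 b)
    simp only [p, dif_pos hex, this]
  refine le_of_eq_of_le ?_ (sum_antithetic_nonpos hf hg C p ?_ ?_)
  · refine Finset.sum_congr (Finset.filter_congr fun ω _ => ?_) fun _ _ => rfl
    constructor
    · intro h i hi
      obtain ⟨b, rfl⟩ := (hC i).1 hi
      obtain ⟨i, hib, j, hjb, hij⟩ := h b.1 b.2
      rw [hp]
      have := hb b
      rw [this, Finset.mem_insert, Finset.mem_singleton] at hib hjb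
      rcases hib with rfl | rfl <;> rcases hjb with rfl | rfl
      · exact absurd rfl hij
      · exact hij
      · exact hij.symm
      · exact absurd rfl hij
    · intro h b hbE
      have := h (q ⟨b, hbE⟩).1 ((hC _).2 ⟨_, rfl⟩)
      rw [hp] at this
      exact ⟨_, m1 ⟨b, hbE⟩, _, m2 ⟨b, hbE⟩, this⟩
  · intro i hi hpi
    obtain ⟨b, rfl⟩ := (hC i).1 hi
    rw [hp] at hpi
    obtain ⟨c, hc⟩ := (hC _).1 hpi
    have : c = b := heq _ _ (q b).2 (hc ▸ m1 c) (m2 b)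
    subst this
    exact hq c hc
  · intro i hi j hj hij
    obtain ⟨b, rfl⟩ := (hC i).1 hi
    obtain ⟨c, rfl⟩ := (hC j).1 hj
    rw [hp, hp] at hij
    rw [heq b c (q b).2 (m2 b) (hij ▸ m2 c)]

/-- Exchanging the sums over `ω` and `η` reduces the claim to a fixed `η` of positive weight, whose
active hyperbonds form a matching. -/
theorem IsRCR.sum_mul_mul_nonpos {ι : Type*} [Fintype ι] [DecidableEq ι] {N : Set ι}
    {B : Finset (Finset ι)} {Q : (ι → Bool) → ℝ} {ν : BinBondConf B → ℝ}
    (h : IsRCR (F := fun _ => Bool) B Q ν) (hanti : IsAntiferromagnetic ν)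
    (hiso : OnIsolatedEdges ν) {f g : (ι → Bool) → ℝ} (hf : OddMono N f) (hg : OddMono Nᶜ g) :
    ∑ ω, Q ω * (f ω * g ω) ≤ 0 := by
  classical
  obtain ⟨hν, Z, hZ, hQ⟩ := h
  have hη : ∀ η : BinBondConf B, ν η * ∑ ω with Compat η ω, f ω * g ω ≤ 0 := by
    intro η
    by_cases h0 : ν η = 0
    · simp [h0]
    refine mul_nonpos_of_nonneg_of_nonpos (hν.nonneg η) ?_
    -- An active hyperbond with fewer than two sites has no non-constant configuration, so nothing
    -- is compatible with `η`.
    by_cases hsmall : ∃ b : {b // b ∈ B}, η b ≠ Finset.univ ∧ b.1.card ≠ 2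
    · obtain ⟨b, hb, hcard⟩ := hsmall
      refine le_of_eq (Finset.sum_eq_zero fun ω hω => ?_)
      simp only [Finset.mem_filter, Finset.mem_univ, true_and] at hω
      have hωb := hω b
      rw [(hanti η h0 b).resolve_right hb] at hωb
      simp only [antiSet, Finset.mem_filter, Finset.mem_univ, true_and] at hωb
      obtain ⟨i, j, hij⟩ := hωb
      have h1 : b.1.card ≤ 1 := by
        have := hiso.1 b.1 b.2
        omega
      exact absurd (congrArg ω (Finset.card_le_one.1 h1 i.1 i.2 j.1 j.2)) hij
    · push Not at hsmall
      let E : Finset (Finset ι) := (Finset.univ.filter fun b : {b // b ∈ B} =>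
        η b ≠ Finset.univ).image Subtype.val
      have hE : ∀ b, b ∈ E ↔ ∃ h : b ∈ B, η ⟨b, h⟩ ≠ Finset.univ := by simp [E]
      refine le_of_eq_of_le ?_ (sum_matching_nonpos hf hg E ?_ ?_)
      · refine Finset.sum_congr (Finset.filter_congr fun ω _ => ?_) fun _ _ => rfl
        constructor
        · intro hω b hb
          obtain ⟨hB, hb⟩ := (hE b).1 hb
          have hωb := hω ⟨b, hB⟩
          rw [(hanti η h0 ⟨b, hB⟩).resolve_right hb] at hωb
          simp only [antiSet, Finset.mem_filter, Finset.mem_univ, true_and] at hωb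
          obtain ⟨i, j, hij⟩ := hωb
          exact ⟨i.1, i.2, j.1, j.2, hij⟩
        · intro hω b
          by_cases hb : η b = Finset.univ
          · rw [hb]
            exact Finset.mem_univ _
          · rw [(hanti η h0 b).resolve_right hb]
            obtain ⟨i, hi, j, hj, hij⟩ := hω b.1 ((hE _).2 ⟨b.2, hb⟩)
            simp only [antiSet, Finset.mem_filter, Finset.mem_univ, true_and]
            exact ⟨⟨i, hi⟩, ⟨j, hj⟩, hij⟩
      · intro b hb
        obtain ⟨hB, hb⟩ := (hE b).1 hb
        exact hsmall _ hb
      · intro b hb c hc hbc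
        obtain ⟨hB, hb⟩ := (hE b).1 hb
        obtain ⟨hB', hc⟩ := (hE c).1 hc
        exact hiso.2 η h0 ⟨b, hB⟩ ⟨c, hB'⟩ (fun h => hbc (congrArg Subtype.val h)) hb hc
  have : ∑ ω, Q ω * (f ω * g ω) =
      (1 / Z) * ∑ η : BinBondConf B, ν η * ∑ ω with Compat η ω, f ω * g ω := by
    simp only [hQ, Finset.mul_sum, Finset.sum_mul, Finset.sum_filter]
    rw [Finset.sum_comm]
    refine Finset.sum_congr rfl fun η _ => Finset.sum_congr rfl fun ω _ => ?_
    by_cases hc : Compat η ω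
    · rw [Set.indicator_of_mem (by exact hc), if_pos hc]
      ring
    · rw [Set.indicator_of_notMem (by exact hc), if_neg hc]
      ring
  rw [this]
  exact mul_nonpos_of_nonneg_of_nonpos (by positivity) (Finset.sum_nonpos fun η _ => hη η)

/-! ### Pairs of configurations and foldings -/

section Fibres

variable {Λ : Type*} {F : Λ → Type*} {M K : Finset Λ}

/-- Every configuration with symbols in `{β₁, β₂}` is described by a binary one. -/
theorem exists_relabel [∀ i, LinearOrder (F i)] (β₁ β₂ : Conf F M) (ω : Conf F M) (h : ∀ i, ω i = β₁ i ∨ ω i = β₂ i) :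
    ∃ ξ, relabel β₁ β₂ ξ = ω := by
  refine ⟨fun i => decide (ω i = max (β₁ i) (β₂ i)), funext fun i => ?_⟩
  simp only [relabel, decide_eq_true_eq]
  split_ifs with hi
  · exact hi.symm
  · rcases le_total (β₁ i) (β₂ i) with hle | hle <;> rcases h i with h | h <;> simp_all

theorem relabel_false_true (ξ : BinConf M) :
    relabel (F := fun _ => Bool) (fun _ => false) (fun _ => true) ξ = ξ := by
  funext i
  simp only [relabel]
  cases ξ i <;> simp

variable [DecidableEq Λ]

theorem concat_of_mem (α : Conf F K) (ω : Conf F (M \ K)) (i : {i // i ∈ M}) (h : i.1 ∈ K) :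
    concat α ω i = α ⟨i.1, h⟩ := dif_pos h

theorem concat_of_notMem (α : Conf F K) (ω : Conf F (M \ K)) (i : {i // i ∈ M}) (h : i.1 ∉ K) :
    concat α ω i = ω ⟨i.1, Finset.mem_sdiff.2 ⟨i.2, h⟩⟩ := dif_neg h

variable [∀ i, LinearOrder (F i)]

/-- The configuration on `M` which is `α` on `K` and on `M \ K` the one described by `ξ`. -/
def insertBin (α : Conf F K) (β₁ β₂ : Conf F (M \ K)) (ξ : BinConf (M \ K)) : Conf F M :=
  concat α (relabel β₁ β₂ ξ)

/-- The difference between the values of `f` at a configuration and at the reverse one. -/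
def foldFun (α : Conf F K) (β₁ β₂ : Conf F (M \ K)) (f : Conf F M → ℝ) (ξ : BinConf (M \ K)) : ℝ :=
  f (insertBin α β₁ β₂ ξ) - f (insertBin α β₁ β₂ fun i => !(ξ i))

theorem insertBin_mono (α : Conf F K) (β₁ β₂ : Conf F (M \ K)) :
    Monotone (insertBin α β₁ β₂) := by
  intro ξ ξ' h i
  by_cases hi : i.1 ∈ K
  · simp only [insertBin, concat_of_mem _ _ i hi, le_refl]
  · simp only [insertBin, concat_of_notMem _ _ i hi, relabel]
    have := h ⟨i.1, Finset.mem_sdiff.2 ⟨i.2, hi⟩⟩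
    revert this
    cases ξ ⟨i.1, _⟩ <;> cases ξ' ⟨i.1, _⟩ <;> simp

theorem oddMono_foldFun (α : Conf F K) (β₁ β₂ : Conf F (M \ K)) {N : Set Λ} {f : Conf F M → ℝ}
    (hf : Monotone f) (hdep : DependsOn f {i | i.1 ∈ N}) :
    OddMono {i | i.1 ∈ N} (foldFun α β₁ β₂ f) where
  mono ξ ξ' h := by
    refine sub_le_sub (hf (insertBin_mono _ _ _ h)) (hf (insertBin_mono _ _ _ fun i => ?_))
    have := h i
    revert this
    change _ → (!(ξ' i)) ≤ !(ξ i)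
    cases ξ i <;> cases ξ' i <;> simp
  odd ξ := by
    simp only [foldFun, Bool.not_not, neg_sub]
  dep ξ ξ' h := by
    have key : ∀ ζ ζ' : BinConf (M \ K), (∀ i, i.1 ∈ N → ζ i = ζ' i) →
        f (insertBin α β₁ β₂ ζ) = f (insertBin α β₁ β₂ ζ') := by
      intro ζ ζ' hζ
      refine hdep fun i hi => ?_
      by_cases hiK : i.1 ∈ K
      · simp only [insertBin, concat_of_mem _ _ i hiK]
      · simp only [insertBin, concat_of_notMem _ _ i hiK, relabel,
          hζ ⟨i.1, Finset.mem_sdiff.2 ⟨i.2, hiK⟩⟩ hi]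
    unfold foldFun
    rw [key ξ ξ' fun i hi => h i hi,
      key (fun i => !(ξ i)) (fun i => !(ξ' i)) fun i hi => congrArg Bool.not (h i hi)]

/-- In binary coordinates the exchange of `β₁` and `β₂` is the global flip, whichever of the two is
larger at each site. -/
theorem foldWeight_relabel (P : Conf F M → ℝ) (α : Conf F K) (β₁ β₂ : Conf F (M \ K))
    (hβ : ∀ i, β₁ i ≠ β₂ i) (ξ : BinConf (M \ K)) :
    foldWeight P K α β₁ β₂ (relabel β₁ β₂ ξ) =
      P (insertBin α β₁ β₂ ξ) * P (insertBin α β₁ β₂ fun i => !(ξ i)) := by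
  have hrev : reverse β₁ β₂ (relabel β₁ β₂ ξ) = relabel β₁ β₂ fun i => !(ξ i) := by
    funext i
    have := hβ i
    simp only [reverse, relabel]
    rcases lt_or_gt_of_ne this with h | h <;>
      rcases Bool.eq_false_or_eq_true (ξ i) with hξ | hξ <;>
      simp [hξ, max_eq_left h.le, max_eq_right h.le, min_eq_left h.le, min_eq_right h.le,
        this.symm]
  rw [foldWeight, if_pos, hrev]
  · rfl
  · intro i
    simp only [relabel]
    rcases le_total (β₁ i) (β₂ i) with h | h <;> cases ξ i <;> simp [h]

/-- The set where the two configurations agree. -/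
def agreeSet (l u : Conf F M) : Finset Λ :=
  (Finset.univ.filter fun i => l i = u i).image Subtype.val

theorem mem_agreeSet (l u : Conf F M) (i : {i // i ∈ M}) : i.1 ∈ agreeSet l u ↔ l i = u i := by
  simp [agreeSet]

theorem agreeSet_subset (l u : Conf F M) : agreeSet l u ⊆ M := by
  intro i hi
  simp only [agreeSet, Finset.mem_image] at hi
  obtain ⟨j, -, rfl⟩ := hi
  exact j.2

/-- The integrand in the symmetrized covariance of `f` and `g` under the weight `Q`. -/
def covTerm {X : Type*} (Q f g : X → ℝ) (x y : X) : ℝ :=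
  Q x * Q y * ((f x - f y) * (g x - g y))

theorem covTerm_insertBin (α : Conf F K) (β₁ β₂ : Conf F (M \ K)) (Q f g : Conf F M → ℝ)
    (ξ : BinConf (M \ K)) :
    covTerm Q f g (insertBin α β₁ β₂ ξ) (insertBin α β₁ β₂ fun i => !(ξ i)) =
      Q (insertBin α β₁ β₂ ξ) * Q (insertBin α β₁ β₂ fun i => !(ξ i)) *
        (foldFun α β₁ β₂ f ξ * foldFun α β₁ β₂ g ξ) := rfl

variable [∀ i, Fintype (F i)]

/-- The pairs of configurations with given minimum `l` and maximum `u` are described by binary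
configurations on the set where `l` and `u` differ. -/
theorem sum_fibre (l u : Conf F M) (hlu : l ≤ u) (hK : K ⊆ M)
    (hKlu : ∀ i : {i // i ∈ M}, i.1 ∈ K ↔ l i = u i) (H : Conf F M → Conf F M → ℝ) :
    ∑ q : Conf F M × Conf F M with (q.1 ⊓ q.2, q.1 ⊔ q.2) = (l, u), H q.1 q.2 =
      ∑ ξ : BinConf (M \ K),
        H (insertBin (fun i => l ⟨i.1, hK i.2⟩) (fun i => l ⟨i.1, Finset.sdiff_subset i.2⟩)
            (fun i => u ⟨i.1, Finset.sdiff_subset i.2⟩) ξ)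
          (insertBin (fun i => l ⟨i.1, hK i.2⟩) (fun i => l ⟨i.1, Finset.sdiff_subset i.2⟩)
            (fun i => u ⟨i.1, Finset.sdiff_subset i.2⟩) fun i => !(ξ i)) := by
  obtain ⟨Φ, hΦ⟩ : ∃ Φ : BinConf (M \ K) → Conf F M, Φ =
    insertBin (fun i => l ⟨i.1, hK i.2⟩) (fun i => l ⟨i.1, Finset.sdiff_subset i.2⟩)
            (fun i => u ⟨i.1, Finset.sdiff_subset i.2⟩) := ⟨_, rfl⟩
  rw [← hΦ]
  have h1 : ∀ ξ i, i.1 ∈ K → Φ ξ i = l i := by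
    intro ξ i hi
    rw [hΦ, insertBin, concat_of_mem _ _ i hi]
  have h2 : ∀ ξ i, (hi : i.1 ∉ K) →
      Φ ξ i = if ξ ⟨i.1, Finset.mem_sdiff.2 ⟨i.2, hi⟩⟩ = true then u i else l i := by
    intro ξ i hi
    rw [hΦ, insertBin, concat_of_notMem _ _ i hi, relabel]
    dsimp only
    rw [max_eq_right (hlu i), min_eq_left (hlu i)]
  -- At each site the two values are `l` and `u` in some order, because `F i` is totally ordered.
  -- The bit records whether the first configuration takes the value `u`.
  symm
  refine Finset.sum_bij' (fun ξ _ => (Φ ξ, Φ fun i => !(ξ i)))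
    (fun q _ i => decide (q.1 ⟨i.1, Finset.sdiff_subset i.2⟩ = u ⟨i.1, Finset.sdiff_subset i.2⟩))
    ?_ ?_ ?_ ?_ ?_
  · intro ξ _
    simp only [Finset.mem_filter, Finset.mem_univ, true_and, Prod.mk.injEq]
    constructor <;> funext i <;> by_cases hi : i.1 ∈ K
    · rw [Pi.inf_apply, h1 _ i hi, h1 _ i hi, inf_idem]
    · rw [Pi.inf_apply, h2 _ i hi, h2 _ i hi]
      cases ξ ⟨i.1, _⟩ <;> simp [hlu i]
    · rw [Pi.sup_apply, h1 _ i hi, h1 _ i hi, sup_idem, (hKlu i).1 hi]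
    · rw [Pi.sup_apply, h2 _ i hi, h2 _ i hi]
      cases ξ ⟨i.1, _⟩ <;> simp [hlu i]
  · simp
  · intro ξ _
    funext i
    have hi := (Finset.mem_sdiff.1 i.2).2
    have hne := mt (hKlu ⟨i.1, Finset.sdiff_subset i.2⟩).2 hi
    refine Bool.eq_iff_iff.2 ?_
    rw [decide_eq_true_iff]
    dsimp only
    rw [h2 _ ⟨i.1, _⟩ hi]
    rcases Bool.eq_false_or_eq_true (ξ i) with hξ | hξ
    · simp [hξ]
    · simpa [hξ] using hne
  · intro q hq
    simp only [Finset.mem_filter, Finset.mem_univ, true_and, Prod.mk.injEq] at hq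
    have hinf : ∀ i, min (q.1 i) (q.2 i) = l i := fun i => congrFun hq.1 i
    have hsup : ∀ i, max (q.1 i) (q.2 i) = u i := fun i => congrFun hq.2 i
    refine Prod.ext (funext fun i => ?_) (funext fun i => ?_) <;> by_cases hi : i.1 ∈ K <;>
      have h3 := hinf i <;> have h4 := hsup i <;> have h5 := hKlu i <;> dsimp only
    · rw [h1 _ i hi]
      refine le_antisymm (h3 ▸ min_le_left _ _) ?_
      rw [h5.1 hi, ← h4]
      exact le_max_left _ _
    · rw [h2 _ i hi]
      simp only [decide_eq_true_eq]
      split_ifs with h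
      · exact h.symm
      · rcases le_total (q.1 i) (q.2 i) with hle | hle
        · rw [← h3, min_eq_left hle]
        · exact absurd (by rw [← h4, max_eq_left hle]) h
    · rw [h1 _ i hi]
      refine le_antisymm (h3 ▸ min_le_right _ _) ?_
      rw [h5.1 hi, ← h4]
      exact le_max_right _ _
    · rw [h2 _ i hi]
      have h6 := mt h5.2 hi
      rcases le_total (q.1 i) (q.2 i) with hle | hle
      · rw [min_eq_left hle] at h3
        rw [max_eq_right hle] at h4
        simp [h3, h4, h6]
      · rw [min_eq_right hle] at h3
        rw [max_eq_left hle] at h4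
        simp [h3, h4]
  · intro ξ _
    rfl

theorem sum_covTerm {X : Type*} [Fintype X] (Q f g : X → ℝ) :
    ∑ q : X × X, covTerm Q f g q.1 q.2 =
      2 * ((∑ x, Q x) * ∑ x, Q x * (f x * g x)) - 2 * ((∑ x, Q x * f x) * ∑ x, Q x * g x) := by
  have h : ∀ x y, covTerm Q f g x y = (Q x * (f x * g x)) * Q y + Q x * (Q y * (f y * g y)) -
      ((Q x * f x) * (Q y * g y) + (Q x * g x) * (Q y * f y)) := by
    intro x y
    unfold covTerm
    ring
  simp only [Fintype.sum_prod_type, h, Finset.sum_sub_distrib, Finset.sum_add_distrib,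
    ← Finset.sum_mul_sum]
  ring

theorem sum_fibre_eq_zero (l u : Conf F M) (hlu : ¬ l ≤ u) (H : Conf F M → Conf F M → ℝ) :
    ∑ q : Conf F M × Conf F M with (q.1 ⊓ q.2, q.1 ⊔ q.2) = (l, u), H q.1 q.2 = 0 := by
  rw [Finset.sum_eq_zero]
  intro q hq
  simp only [Finset.mem_filter, Finset.mem_univ, true_and, Prod.mk.injEq] at hq
  exact absurd (hq.1 ▸ hq.2 ▸ inf_le_left.trans le_sup_left) hlu

/-- If all foldings are negatively correlated, so is the weight itself. -/
theorem sum_covTerm_nonpos (Q f g : Conf F M → ℝ)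
    (h : ∀ K ⊆ M, ∀ (α : Conf F K) (β₁ β₂ : Conf F (M \ K)), (∀ i, β₁ i ≠ β₂ i) →
      ∑ ξ, Q (insertBin α β₁ β₂ ξ) * Q (insertBin α β₁ β₂ fun i => !(ξ i)) *
        (foldFun α β₁ β₂ f ξ * foldFun α β₁ β₂ g ξ) ≤ 0) :
    ∑ q : Conf F M × Conf F M, covTerm Q f g q.1 q.2 ≤ 0 := by
  rw [← Finset.sum_fiberwise Finset.univ
    (fun q : Conf F M × Conf F M => (q.1 ⊓ q.2, q.1 ⊔ q.2)) fun q => covTerm Q f g q.1 q.2]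
  refine Finset.sum_nonpos fun k _ => ?_
  obtain ⟨l, u⟩ := k
  by_cases hlu : l ≤ u
  · rw [sum_fibre l u hlu (agreeSet_subset l u) (mem_agreeSet l u)]
    simp only [covTerm_insertBin]
    refine h _ (agreeSet_subset l u) _ _ _ fun i hi => ?_
    exact (Finset.mem_sdiff.1 i.2).2 ((mem_agreeSet l u ⟨i.1, Finset.sdiff_subset i.2⟩).2 hi)
  · exact (sum_fibre_eq_zero l u hlu _).le

end Fibres

/-! ### Symmetric binary weights and the effect of squaring -/

section Binary

variable {Λ : Type*} [DecidableEq Λ] {M : Finset Λ}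

theorem insertBin_false_true {K : Finset Λ} (α : BinConf K) (ξ : BinConf (M \ K)) :
    insertBin (F := fun _ => Bool) α (fun _ => false) (fun _ => true) ξ = concat α ξ := by
  rw [insertBin, relabel_false_true]

/-- A symmetric weight all of whose foldings with non-empty `K` are negatively correlated becomes
more positively correlated by squaring. -/
theorem sum_mul_sum_le_sum_sq (R : BinConf M → ℝ) (hsym : ∀ ω, R (fun i => !(ω i)) = R ω)
    {f g : BinConf M → ℝ} (hfo : ∀ ω, f (fun i => !(ω i)) = -f ω)
    (hgo : ∀ ω, g (fun i => !(ω i)) = -g ω)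
    (h : ∀ K ⊆ M, K.Nonempty → ∀ (α : BinConf K),
      ∑ ξ : BinConf (M \ K), R (concat α ξ) * R (concat α fun i => !(ξ i)) *
        (foldFun (F := fun _ => Bool) α (fun _ => false) (fun _ => true) f ξ *
          foldFun (F := fun _ => Bool) α (fun _ => false) (fun _ => true) g ξ) ≤ 0) :
    (∑ ω, R ω) * ∑ ω, R ω * (f ω * g ω) ≤ 2 * ∑ ω, R ω ^ 2 * (f ω * g ω) := by
  have hzero : ∑ ω, R ω * f ω = 0 := by
    have e : ∑ ω : BinConf M, R (fun i => !(ω i)) * f (fun i => !(ω i)) = ∑ ω, R ω * f ω :=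
      ((Equiv.refl {i // i ∈ M}).arrowCongr Equiv.boolNot).sum_comp fun ω => R ω * f ω
    simp only [hsym, hfo, mul_neg, Finset.sum_neg_distrib] at e
    linarith
  -- The fibre over `(⊥, ⊤)` consists of the pairs of mutually reverse configurations. There oddness
  -- doubles both differences, whence the factor 4.
  have hfib : ∀ k : BinConf M × BinConf M,
      ∑ q : BinConf M × BinConf M with (q.1 ⊓ q.2, q.1 ⊔ q.2) = k, covTerm R f g q.1 q.2 ≤
        if k = (⊥, ⊤) then 4 * ∑ ω, R ω ^ 2 * (f ω * g ω) else 0 := by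
    rintro ⟨l, u⟩
    split_ifs with hk
    · rw [hk, Finset.mul_sum]
      refine le_of_eq (Finset.sum_bij' (fun q _ => q.1) (fun ω _ => (ω, fun i => !(ω i)))
        ?_ ?_ ?_ ?_ ?_)
      · simp
      · intro ω _
        simp only [Finset.mem_filter, Finset.mem_univ, true_and, Prod.mk.injEq]
        constructor <;> funext i <;> simp
      · intro q hq
        simp only [Finset.mem_filter, Finset.mem_univ, true_and, Prod.mk.injEq] at hq
        refine Prod.ext rfl (funext fun i => ?_)
        have h1 := congrFun hq.1 i
        have h2 := congrFun hq.2 i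
        revert h1 h2
        simp only [Pi.inf_apply, Pi.sup_apply, Pi.bot_apply, Pi.top_apply]
        cases q.1 i <;> cases q.2 i <;> simp
      · intro ω _
        rfl
      · intro q hq
        have hq2 : q.2 = fun i => !(q.1 i) := by
          simp only [Finset.mem_filter, Finset.mem_univ, true_and, Prod.mk.injEq] at hq
          refine funext fun i => ?_
          have h1 := congrFun hq.1 i
          have h2 := congrFun hq.2 i
          revert h1 h2
          simp only [Pi.inf_apply, Pi.sup_apply, Pi.bot_apply, Pi.top_apply]
          cases q.1 i <;> cases q.2 i <;> simp
        rw [covTerm, hq2, hsym, hfo, hgo]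
        ring
    · by_cases hlu : l ≤ u
      · have hb : ∀ a b : Bool, a ≤ b → a ≠ b → a = false ∧ b = true := by decide
        have hlt : ∀ i : {i // i ∈ M}, i.1 ∉ agreeSet l u → l i = false ∧ u i = true := by
          intro i hi
          exact hb _ _ (hlu i) (mt (mem_agreeSet l u i).2 hi)
        -- For `l ≤ u` over the binary alphabet, disagreement at every site would force `l = ⊥` and
        -- `u = ⊤`.
        have hne : (agreeSet l u).Nonempty := by
          rw [Finset.nonempty_iff_ne_empty]
          intro hemp
          refine hk (Prod.ext (funext fun i => ?_) (funext fun i => ?_))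
          · exact (hlt i (by simp [hemp])).1
          · exact (hlt i (by simp [hemp])).2
        rw [sum_fibre (F := fun _ => Bool) l u hlu (agreeSet_subset l u) (mem_agreeSet l u)]
        have e1 : (fun i : {i // i ∈ M \ agreeSet l u} => l ⟨i.1, Finset.sdiff_subset i.2⟩) =
            fun _ => false :=
          funext fun i => (hlt ⟨i.1, _⟩ (Finset.mem_sdiff.1 i.2).2).1
        have e2 : (fun i : {i // i ∈ M \ agreeSet l u} => u ⟨i.1, Finset.sdiff_subset i.2⟩) =
            fun _ => true :=
          funext fun i => (hlt ⟨i.1, _⟩ (Finset.mem_sdiff.1 i.2).2).2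
        rw [e1, e2]
        simp only [covTerm_insertBin]
        simpa only [insertBin_false_true] using h _ (agreeSet_subset l u) hne _
      · exact (sum_fibre_eq_zero (F := fun _ => Bool) l u hlu _).le
  have hsum := Finset.sum_le_sum fun k (_ : k ∈ Finset.univ) => hfib k
  rw [Finset.sum_fiberwise Finset.univ
    (fun q : BinConf M × BinConf M => (q.1 ⊓ q.2, q.1 ⊔ q.2)) fun q => covTerm R f g q.1 q.2,
    sum_covTerm, hzero] at hsum
  simp only [Finset.sum_ite_eq', Finset.mem_univ, if_true] at hsum
  linarith

end Binary

/-! ### Limits of powers -/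

/-- After division by the maximum of `R`, powers tend to the indicator of the maximizers; the limit
is uniform on them. -/
theorem exists_tendsto_pow_div_sum {X : Type*} [Fintype X] (R : X → ℝ) (hR : ∀ x, 0 ≤ R x)
    (hne : ∃ x, R x ≠ 0) :
    ∃ Q : X → ℝ, ∀ x, Tendsto (fun m : ℕ => R x ^ 2 ^ m / ∑ y, R y ^ 2 ^ m) atTop (𝓝 (Q x)) := by
  classical
  obtain ⟨z, hz⟩ := hne
  obtain ⟨x₀, -, hx₀⟩ := Finset.exists_max_image Finset.univ R ⟨z, Finset.mem_univ z⟩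
  have hpos : 0 < R x₀ := ((hR z).lt_of_ne' hz).trans_le (hx₀ z (Finset.mem_univ z))
  have hlim : ∀ x, Tendsto (fun m : ℕ => (R x / R x₀) ^ 2 ^ m) atTop
      (𝓝 (if R x = R x₀ then 1 else 0)) := by
    intro x
    split_ifs with h
    · rw [h, div_self hpos.ne']
      simp
    · have hlt : R x < R x₀ := lt_of_le_of_ne (hx₀ x (Finset.mem_univ x)) h
      exact (tendsto_pow_atTop_nhds_zero_of_lt_one (div_nonneg (hR x) hpos.le)
        ((div_lt_one hpos).2 hlt)).comp (tendsto_pow_atTop_atTop_of_one_lt one_lt_two)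
  have hsum : (∑ y, if R y = R x₀ then (1 : ℝ) else 0) ≠ 0 := by
    refine (Finset.sum_pos' (fun y _ => ?_) ⟨x₀, Finset.mem_univ x₀, ?_⟩).ne'
    · split_ifs <;> norm_num
    · simp
  refine ⟨_, fun x => ((hlim x).div (tendsto_finsetSum Finset.univ fun y _ => hlim y) hsum).congr
    fun m => ?_⟩
  simp only [div_pow, ← Finset.sum_div]
  exact div_div_div_cancel_right₀ (pow_ne_zero _ hpos.ne') _ _

/-- If squaring increases the correlation, a positive correlation persists in the limit. -/
theorem sum_limit_pos {ι : Type*} [Fintype ι] [DecidableEq ι] [Nonempty ι] (R Q h : (ι → Bool) → ℝ)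
    (hR : ∀ x, 0 ≤ R x) (hsym : ∀ ω, R (fun i => !(ω i)) = R ω) (hne : ∃ x, R x ≠ 0)
    (hstep : ∀ m : ℕ, (∑ ω, R ω ^ 2 ^ m) * ∑ ω, R ω ^ 2 ^ m * h ω ≤
      2 * ∑ ω, R ω ^ 2 ^ (m + 1) * h ω)
    (hQ : ∀ x, Tendsto (fun m : ℕ => R x ^ 2 ^ m / ∑ y, R y ^ 2 ^ m) atTop (𝓝 (Q x)))
    (m₀ : ℕ) (hm₀ : 0 < ∑ ω, R ω ^ 2 ^ m₀ * h ω) : 0 < ∑ ω, Q ω * h ω := by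
  have hSpos : ∀ m : ℕ, 0 < ∑ ω, R ω ^ 2 ^ m := by
    intro m
    obtain ⟨x, hx⟩ := hne
    exact Finset.sum_pos' (fun y _ => pow_nonneg (hR y) _)
      ⟨x, Finset.mem_univ x, pow_pos ((hR x).lt_of_ne' hx) _⟩
  -- On a non-empty set of sites a configuration differs from its reverse and has the same weight,
  -- so no single weight exceeds half the total.
  have hhalf : ∀ m : ℕ, 2 * ∑ ω, R ω ^ 2 ^ (m + 1) ≤ (∑ ω, R ω ^ 2 ^ m) ^ 2 := by
    intro m
    have hmax : ∀ ω, 2 * R ω ^ 2 ^ m ≤ ∑ ω, R ω ^ 2 ^ m := by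
      intro ω
      have hω : ω ≠ fun i => !(ω i) := fun hω => by
        obtain ⟨i⟩ := ‹Nonempty ι›
        have := congrFun hω i
        simp at this
      calc 2 * R ω ^ 2 ^ m = ∑ x ∈ {ω, fun i => !(ω i)}, R x ^ 2 ^ m := by
            rw [Finset.sum_pair hω, hsym]
            ring
        _ ≤ _ := Finset.sum_le_sum_of_subset_of_nonneg (Finset.subset_univ _)
            fun y _ _ => pow_nonneg (hR y) _
    rw [sq, Finset.mul_sum, Finset.sum_mul]
    refine Finset.sum_le_sum fun ω _ => ?_
    rw [pow_succ 2 m, pow_mul, sq]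
    nlinarith [hmax ω, pow_nonneg (hR ω) (2 ^ m)]
  have hmono : ∀ m : ℕ, (0 < ∑ ω, R ω ^ 2 ^ m * h ω) → (0 < ∑ ω, R ω ^ 2 ^ (m + 1) * h ω) ∧
      (∑ ω, R ω ^ 2 ^ m * h ω) / ∑ ω, R ω ^ 2 ^ m ≤
        (∑ ω, R ω ^ 2 ^ (m + 1) * h ω) / ∑ ω, R ω ^ 2 ^ (m + 1) := by
    intro m hm
    have h1 := hstep m
    have h2 := hhalf m
    have h3 := hSpos m
    have h4 := hSpos (m + 1)
    have h5 : 0 < ∑ ω, R ω ^ 2 ^ (m + 1) * h ω := by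
      have := mul_pos h3 hm
      linarith
    refine ⟨h5, ?_⟩
    rw [div_le_div_iff₀ h3 h4]
    have h6 := mul_le_mul_of_nonneg_left h2 hm.le
    have h7 := mul_le_mul_of_nonneg_right h1 h3.le
    nlinarith
  have hall : ∀ j : ℕ, (0 < ∑ ω, R ω ^ 2 ^ (m₀ + j) * h ω) ∧
      (∑ ω, R ω ^ 2 ^ m₀ * h ω) / ∑ ω, R ω ^ 2 ^ m₀ ≤
        (∑ ω, R ω ^ 2 ^ (m₀ + j) * h ω) / ∑ ω, R ω ^ 2 ^ (m₀ + j) := by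
    intro j
    induction j with
    | zero => exact ⟨hm₀, le_rfl⟩
    | succ j ih => exact ⟨(hmono _ ih.1).1, ih.2.trans (hmono _ ih.1).2⟩
  have hlim : Tendsto (fun m : ℕ => (∑ ω, R ω ^ 2 ^ m * h ω) / ∑ ω, R ω ^ 2 ^ m) atTop
      (𝓝 (∑ ω, Q ω * h ω)) := by
    refine (tendsto_finsetSum Finset.univ fun ω _ => (hQ ω).mul_const (h ω)).congr fun m => ?_
    rw [Finset.sum_div]
    exact Finset.sum_congr rfl fun ω _ => by ring
  refine (div_pos hm₀ (hSpos m₀)).trans_le (ge_of_tendsto hlim ?_)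
  filter_upwards [eventually_ge_atTop m₀] with m hm
  obtain ⟨j, rfl⟩ := Nat.exists_eq_add_of_le hm
  exact (hall j).2

/-! ### States of the tree of foldings -/

section States

variable {Λ : Type*} [DecidableEq Λ]

/-- For transport along `rest (L + m) = rest L`, which is not a definitional equality. -/
theorem sum_restrict {M M' : Finset Λ} (h : M' = M) (k : BinConf M' → ℝ) :
    ∑ ω, k ω = ∑ ω : BinConf M, k fun i => ω ⟨i.1, h ▸ i.2⟩ := by
  subst h
  rfl

theorem foldWeight_false_true {M K : Finset Λ} (R : BinConf M → ℝ) (α : BinConf K)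
    (ξ : BinConf (M \ K)) :
    foldWeight (F := fun _ => Bool) R K α (fun _ => false) (fun _ => true) ξ =
      R (concat α ξ) * R (concat α fun i => !(ξ i)) := by
  have := foldWeight_relabel (F := fun _ => Bool) R α (fun _ => false) (fun _ => true)
    (fun _ => Bool.false_ne_true) ξ
  rwa [relabel_false_true, insertBin_false_true, insertBin_false_true] at this

/-- A set of sites with a weight on its binary configurations. -/
abbrev State (Λ : Type*) : Type _ := Σ M : Finset Λ, (BinConf M → ℝ)

/-- The data of a folding of a binary weight. -/
abbrev FoldStep (Λ : Type*) : Type _ := Σ K : Finset Λ, BinConf K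

/-- The folding of a binary weight. -/
noncomputable abbrev State.step (X : State Λ) (k : FoldStep Λ) : State Λ :=
  ⟨X.1 \ k.1, fold (F := fun _ => Bool) X.2 k.1 k.2 (fun _ => false) (fun _ => true)⟩

/-- The folding is defined. -/
def State.Defined (X : State Λ) (k : FoldStep Λ) : Prop :=
  ∃ ω, foldWeight (F := fun _ => Bool) X.2 k.1 k.2 (fun _ => false) (fun _ => true) ω ≠ 0

/-- A non-negative, symmetric and non-zero weight. -/
structure State.Admissible (X : State Λ) : Prop where
  nonneg : ∀ ω, 0 ≤ X.2 ω
  symm : ∀ ω, X.2 (fun i => !(ω i)) = X.2 ω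
  ne_zero : ∃ ω, X.2 ω ≠ 0

/-- Under the powers `2 ^ m` of the weight, odd increasing functions with disjoint supports are
negatively correlated. -/
def State.NegCorrelated (X : State Λ) : Prop :=
  ∀ (m : ℕ) (N : Set Λ) (f g : BinConf X.1 → ℝ), OddMono {i | i.1 ∈ N} f →
    OddMono {i | i.1 ∈ N}ᶜ g → ∑ ω, X.2 ω ^ 2 ^ m * (f ω * g ω) ≤ 0

theorem State.Admissible.sum_foldWeight_pos {X : State Λ} (hX : X.Admissible) {k : FoldStep Λ}
    (hk : X.Defined k) :
    0 < ∑ ω, foldWeight (F := fun _ => Bool) X.2 k.1 k.2 (fun _ => false) (fun _ => true) ω := by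
  obtain ⟨ω, hω⟩ := hk
  have h0 : ∀ ω, 0 ≤
      foldWeight (F := fun _ => Bool) X.2 k.1 k.2 (fun _ => false) (fun _ => true) ω := by
    intro ω
    rw [foldWeight_false_true]
    exact mul_nonneg (hX.nonneg _) (hX.nonneg _)
  exact Finset.sum_pos' (fun ω _ => h0 ω) ⟨ω, Finset.mem_univ ω, (h0 ω).lt_of_ne' hω⟩

theorem State.Admissible.step {X : State Λ} (hX : X.Admissible) {k : FoldStep Λ}
    (hk : X.Defined k) : (X.step k).Admissible := by
  have hZ := hX.sum_foldWeight_pos hk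
  refine ⟨fun ω => ?_, fun ω => ?_, ?_⟩
  · refine div_nonneg ?_ hZ.le
    rw [foldWeight_false_true]
    exact mul_nonneg (hX.nonneg _) (hX.nonneg _)
  · simp only [State.step, fold, foldWeight_false_true, Bool.not_not]
    rw [mul_comm (X.2 (concat k.2 fun i => !(ω i)))]
  · obtain ⟨ω, hω⟩ := hk
    exact ⟨ω, div_ne_zero hω hZ.ne'⟩

/-- By symmetry the weight of a folding with empty `K` is a square, so it vanishes only where the
original weight does. -/
theorem State.Admissible.defined_of_eq_empty {X : State Λ} (hX : X.Admissible) {k : FoldStep Λ}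
    (hk : k.1 = ∅) : X.Defined k := by
  obtain ⟨ω, hω⟩ := hX.ne_zero
  have hc : ∀ ω : BinConf X.1,
      concat k.2 (fun i : {i // i ∈ X.1 \ k.1} => ω ⟨i.1, Finset.sdiff_subset i.2⟩) = ω :=
    fun ω => funext fun i => concat_of_notMem _ _ i (by simp [hk])
  refine ⟨fun i => ω ⟨i.1, Finset.sdiff_subset i.2⟩, ?_⟩
  rw [foldWeight_false_true, hc, hc fun i => !(ω i), hX.symm]
  exact mul_ne_zero hω hω

/-- The weight is negatively correlated if its foldings with non-empty `K` and the limit of its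
powers are. -/
theorem State.Admissible.negCorrelated {X : State Λ} (hX : X.Admissible)
    (hstep : ∀ k : FoldStep Λ, k.1 ⊆ X.1 → k.1.Nonempty → X.Defined k →
      (X.step k).NegCorrelated)
    (Q : BinConf X.1 → ℝ)
    (hQ : ∀ x, Tendsto (fun m : ℕ => X.2 x ^ 2 ^ m / ∑ y, X.2 y ^ 2 ^ m) atTop (𝓝 (Q x)))
    (hlim : ∀ (N : Set Λ) (f g : BinConf X.1 → ℝ), OddMono {i | i.1 ∈ N} f →
      OddMono {i | i.1 ∈ N}ᶜ g → ∑ ω, Q ω * (f ω * g ω) ≤ 0) :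
    X.NegCorrelated := by
  intro m N f g hf hg
  by_contra hpos
  rw [not_le] at hpos
  -- Without sites the only configuration is its own reverse, and odd functions vanish on it.
  rcases isEmpty_or_nonempty {i // i ∈ X.1} with hemp | hne
  · refine hpos.ne' (Finset.sum_eq_zero fun ω _ => ?_)
    have h1 : (fun i => !(ω i)) = ω := Subsingleton.elim _ _
    have h2 := hf.odd ω
    rw [h1] at h2
    have h3 : f ω = 0 := by linarith
    simp [h3]
  refine absurd (hlim N f g hf hg) (not_le.2 (sum_limit_pos X.2 Q (fun ω => f ω * g ω) hX.nonneg
    hX.symm hX.ne_zero (fun j => ?_) hQ m hpos))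
  have := sum_mul_sum_le_sum_sq (fun ω => X.2 ω ^ 2 ^ j) (fun ω => by rw [hX.symm]) hf.odd hg.odd
    fun K hK hKne α => ?_
  · refine this.trans_eq ?_
    simp only [← pow_mul, ← pow_succ]
  -- Up to a constant, folding the `2 ^ j`-th power is the `2 ^ j`-th power of the folding. If the
  -- folding is undefined, all its weights are zero.
  · by_cases hdef : X.Defined ⟨K, α⟩
    · have hZ := hX.sum_foldWeight_pos hdef
      have hcor := hstep ⟨K, α⟩ hK hKne hdef j N _ _
        (oddMono_foldFun (F := fun _ => Bool) α (fun _ => false) (fun _ => true) hf.mono hf.dep)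
        (oddMono_foldFun (F := fun _ => Bool) (N := Nᶜ) α (fun _ => false) (fun _ => true)
          hg.mono hg.dep)
      simp only [State.step, fold, foldWeight_false_true, div_pow, mul_pow] at hcor hZ
      have hZ' := pow_pos hZ (2 ^ j)
      refine le_of_eq_of_le ?_ (mul_nonpos_of_nonneg_of_nonpos hZ'.le hcor)
      rw [Finset.mul_sum]
      refine Finset.sum_congr rfl fun ξ _ => ?_
      rw [div_mul_eq_mul_div, mul_div_cancel₀ _ hZ'.ne']
    · refine (Finset.sum_eq_zero fun ξ _ => ?_).le
      have h0 : X.2 (concat α ξ) * X.2 (concat α fun i => !(ξ i)) = 0 := by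
        rw [← foldWeight_false_true]
        by_contra h
        exact hdef ⟨ξ, h⟩
      rw [← mul_pow, h0, zero_pow (by positivity), zero_mul]

end States

/-! ### Branches -/

namespace FoldSeq

variable {Λ : Type*} [Fintype Λ] [DecidableEq Λ] {F : Λ → Type*}

theorem rest_add_eq (s : FoldSeq F) {L : ℕ} (h : ∀ n, L ≤ n → s.K (n + 1) = ∅) (m : ℕ) :
    s.rest (L + m) = s.rest L := by
  induction m with
  | zero => rfl
  | succ m ih =>
    change s.rest (L + m) \ s.K (L + m + 1) = _
    rw [h _ (Nat.le_add_right L m), Finset.sdiff_empty, ih]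

/-- The sequence with the same first folding and given later foldings. -/
def withSteps (r : FoldSeq F) (st : ℕ → FoldStep Λ) : FoldSeq F where
  K := fun n => match n with
    | 0 => r.K 0
    | n + 1 => (st n).1
  α₀ := r.α₀
  α := fun n => (st n).2
  β₁ := r.β₁
  β₂ := r.β₂

variable [∀ i, Fintype (F i)] [∀ i, LinearOrder (F i)]

theorem node_add_succ (s : FoldSeq F) (P : (∀ i, F i) → ℝ) {L : ℕ}
    (h : ∀ n, L ≤ n → s.K (n + 1) = ∅) (m : ℕ) (ω : BinConf (s.rest L)) :
    (s.node P (L + (m + 1)) fun i => ω ⟨i.1, s.rest_add_subset L (m + 1) i.2⟩) =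
      ((s.node P (L + m) fun i => ω ⟨i.1, s.rest_add_subset L m i.2⟩) *
        (s.node P (L + m) fun i => !(ω ⟨i.1, s.rest_add_subset L m i.2⟩))) /
      ∑ ω' : BinConf (s.rest L),
        (s.node P (L + m) fun i => ω' ⟨i.1, s.rest_add_subset L m i.2⟩) *
          (s.node P (L + m) fun i => !(ω' ⟨i.1, s.rest_add_subset L m i.2⟩)) := by
  have hK := h (L + m) (Nat.le_add_right L m)
  have hw : ∀ ω : BinConf (s.rest L), foldWeight (F := fun _ => Bool) (s.node P (L + m))
      (s.K (L + m + 1)) (s.α (L + m)) (fun _ => false) (fun _ => true)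
      (fun i => ω ⟨i.1, s.rest_add_subset L (m + 1) i.2⟩) =
      (s.node P (L + m) fun i => ω ⟨i.1, s.rest_add_subset L m i.2⟩) *
        (s.node P (L + m) fun i => !(ω ⟨i.1, s.rest_add_subset L m i.2⟩)) := by
    intro ω
    have hc : ∀ ω : BinConf (s.rest L), concat (M := s.rest (L + m)) (s.α (L + m))
        (fun i => ω ⟨i.1, s.rest_add_subset L (m + 1) i.2⟩) =
        fun i => ω ⟨i.1, s.rest_add_subset L m i.2⟩ :=
      fun ω => funext fun i => concat_of_notMem _ _ i (by simp [hK])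
    rw [foldWeight_false_true, hc, hc fun i => !(ω i)]
  exact congrArg₂ (· / ·) (hw ω) ((sum_restrict (s.rest_add_eq h (m + 1)) _).trans
    (Finset.sum_congr rfl fun ω' _ => hw ω'))

/-- The iterated folding with its set of sites. -/
noncomputable abbrev state (s : FoldSeq F) (P : (∀ i, F i) → ℝ) (n : ℕ) : State Λ :=
  ⟨s.rest n, s.node P n⟩

/-- A folding with empty `K` squares a symmetric weight up to normalization, so the node at `L + m`
is the normalized `2 ^ m`-th power of the node at `L`. -/
theorem exists_isLimit (s : FoldSeq F) (P : (∀ i, F i) → ℝ) {L : ℕ}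
    (h : ∀ n, L ≤ n → s.K (n + 1) = ∅) (hX : (s.state P L).Admissible) :
    ∃ Q, s.IsLimit P L Q ∧ ∀ x, Tendsto (fun m : ℕ =>
      s.node P L x ^ 2 ^ m / ∑ y, s.node P L y ^ 2 ^ m) atTop (𝓝 (Q x)) := by
  obtain ⟨Q, hQ⟩ := exists_tendsto_pow_div_sum (s.node P L) hX.nonneg hX.ne_zero
  refine ⟨Q, fun ω => ?_, hQ⟩
  have hS : ∀ m : ℕ, (∑ y, s.node P L y ^ 2 ^ m) ≠ 0 := by
    intro m
    obtain ⟨x, hx⟩ := hX.ne_zero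
    exact (Finset.sum_pos' (fun y _ => pow_nonneg (hX.nonneg y) _)
      ⟨x, Finset.mem_univ x, pow_pos ((hX.nonneg x).lt_of_ne' hx) _⟩).ne'
  -- The constant `c` is arbitrary because admissible weights need not be normalized: the start `m =
  -- 0` uses `c = 1`, and the closed formula holds from `m + 1` on.
  have hpow : ∀ (m : ℕ) (c : ℝ), c ≠ 0 →
      (∀ ω : BinConf (s.rest L), (s.node P (L + m) fun i =>
        ω ⟨i.1, s.rest_add_subset L m i.2⟩) = s.node P L ω ^ 2 ^ m / c) →
      ∀ ω : BinConf (s.rest L), (s.node P (L + (m + 1)) fun i =>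
        ω ⟨i.1, s.rest_add_subset L (m + 1) i.2⟩) =
          s.node P L ω ^ 2 ^ (m + 1) / ∑ y, s.node P L y ^ 2 ^ (m + 1) := by
    intro m c hc hm ω
    have hterm : ∀ ω : BinConf (s.rest L),
        (s.node P (L + m) fun i => ω ⟨i.1, s.rest_add_subset L m i.2⟩) *
          (s.node P (L + m) fun i => !(ω ⟨i.1, s.rest_add_subset L m i.2⟩)) =
        s.node P L ω ^ 2 ^ (m + 1) / c ^ 2 := by
      intro ω
      have hsymm : s.node P L (fun i => !(ω i)) = s.node P L ω := hX.symm ω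
      rw [hm, hm fun i => !(ω i), hsymm, ← sq, div_pow, ← pow_mul, ← pow_succ]
    rw [node_add_succ s P h]
    simp only [hterm, ← Finset.sum_div]
    exact div_div_div_cancel_right₀ (pow_ne_zero 2 hc) _ _
  have hall : ∀ (m : ℕ) (ω : BinConf (s.rest L)), (s.node P (L + (m + 1)) fun i =>
      ω ⟨i.1, s.rest_add_subset L (m + 1) i.2⟩) =
        s.node P L ω ^ 2 ^ (m + 1) / ∑ y, s.node P L y ^ 2 ^ (m + 1) := by
    intro m
    induction m with
    | zero =>
      refine hpow 0 1 one_ne_zero fun ω => ?_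
      rw [pow_zero, pow_one, div_one]
      rfl
    | succ m ih => exact hpow (m + 1) _ (hS (m + 1)) ih
  refine (tendsto_add_atTop_iff_nat 1).1 (((tendsto_add_atTop_iff_nat 1).2 (hQ ω)).congr
    fun m => ?_)
  exact (hall m ω).symm

theorem withSteps_state_succ (r : FoldSeq F) (P : (∀ i, F i) → ℝ) (st : ℕ → FoldStep Λ) (n : ℕ) :
    (r.withSteps st).state P (n + 1) = ((r.withSteps st).state P n).step (st n) := rfl

theorem withSteps_state_congr (r : FoldSeq F) (P : (∀ i, F i) → ℝ) {st st' : ℕ → FoldStep Λ}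
    {n : ℕ} (h : ∀ j < n, st j = st' j) :
    (r.withSteps st).state P n = (r.withSteps st').state P n := by
  induction n with
  | zero => rfl
  | succ n ih =>
    rw [withSteps_state_succ, withSteps_state_succ, ih fun j hj => h j (hj.trans n.lt_succ_self),
      h n n.lt_succ_self]

/-- The first folding is defined. -/
structure RootDefined (r : FoldSeq F) (P : (∀ i, F i) → ℝ) : Prop where
  beta_ne : ∀ i, r.β₁ i ≠ r.β₂ i
  defined_zero : ∃ ω, foldWeight (M := Finset.univ)
    (fun ω => P fun i => ω ⟨i, Finset.mem_univ i⟩) (r.K 0) r.α₀ r.β₁ r.β₂ ω ≠ 0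

theorem node_zero (r : FoldSeq F) (P : (∀ i, F i) → ℝ) (hβ : ∀ i, r.β₁ i ≠ r.β₂ i)
    (ξ : BinConf (r.rest 0)) : r.node P 0 ξ =
      (P (fun i => insertBin r.α₀ r.β₁ r.β₂ ξ ⟨i, Finset.mem_univ i⟩) *
        P (fun i => insertBin r.α₀ r.β₁ r.β₂ (fun j => !(ξ j)) ⟨i, Finset.mem_univ i⟩)) /
      ∑ ω, foldWeight (M := Finset.univ) (fun ω => P fun i => ω ⟨i, Finset.mem_univ i⟩)
        (r.K 0) r.α₀ r.β₁ r.β₂ ω := by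
  change fold (M := Finset.univ) _ _ _ _ _ _ = _
  rw [fold]
  congr 1
  exact foldWeight_relabel _ _ _ _ hβ _

theorem RootDefined.sum_pos {r : FoldSeq F} {P : (∀ i, F i) → ℝ} (hr : r.RootDefined P)
    (hP : ∀ ω, 0 ≤ P ω) : 0 < ∑ ω, foldWeight (M := Finset.univ)
      (fun ω => P fun i => ω ⟨i, Finset.mem_univ i⟩) (r.K 0) r.α₀ r.β₁ r.β₂ ω := by
  obtain ⟨ω, hω⟩ := hr.defined_zero
  have h0 : ∀ ω, 0 ≤ foldWeight (M := Finset.univ)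
      (fun ω => P fun i => ω ⟨i, Finset.mem_univ i⟩) (r.K 0) r.α₀ r.β₁ r.β₂ ω := by
    intro ω
    unfold foldWeight
    split_ifs
    · exact mul_nonneg (hP _) (hP _)
    · exact le_rfl
  exact Finset.sum_pos' (fun ω _ => h0 ω) ⟨ω, Finset.mem_univ ω, (h0 ω).lt_of_ne' hω⟩

theorem RootDefined.admissible {r : FoldSeq F} {P : (∀ i, F i) → ℝ} (hr : r.RootDefined P)
    (hP : ∀ ω, 0 ≤ P ω) : (r.state P 0).Admissible := by
  have hZ := hr.sum_pos hP
  refine ⟨fun ξ => ?_, fun ξ => ?_, ?_⟩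
  · change 0 ≤ r.node P 0 ξ
    rw [node_zero r P hr.beta_ne]
    exact div_nonneg (mul_nonneg (hP _) (hP _)) hZ.le
  · change r.node P 0 _ = r.node P 0 ξ
    rw [node_zero r P hr.beta_ne, node_zero r P hr.beta_ne]
    simp only [Bool.not_not]
    rw [mul_comm]
    rfl
  · obtain ⟨ω, hω⟩ := hr.defined_zero
    have hmem : ∀ i, ω i = r.β₁ i ∨ ω i = r.β₂ i := by
      by_contra h
      exact hω (if_neg h)
    obtain ⟨ξ, rfl⟩ := exists_relabel r.β₁ r.β₂ ω hmem
    exact ⟨ξ, div_ne_zero hω hZ.ne'⟩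

/-- The first `L` later foldings are defined and have non-empty sets, the following ones have
empty sets. -/
structure ValidSteps (r : FoldSeq F) (P : (∀ i, F i) → ℝ) (st : ℕ → FoldStep Λ) (L : ℕ) : Prop where
  nonempty : ∀ n < L, (st n).1.Nonempty
  subset : ∀ n < L, (st n).1 ⊆ ((r.withSteps st).state P n).1
  defined : ∀ n < L, ((r.withSteps st).state P n).Defined (st n)
  eq_empty : ∀ n, L ≤ n → (st n).1 = ∅

/-- The steps after `L` are defined because the states are admissible, and each state is admissible
because the step before it is defined; one induction yields both. -/
theorem ValidSteps.defined_all {r : FoldSeq F} {P : (∀ i, F i) → ℝ} {st : ℕ → FoldStep Λ} {L : ℕ}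
    (hst : r.ValidSteps P st L) (hr : r.RootDefined P) (hP : ∀ ω, 0 ≤ P ω) (n : ℕ) :
    ((r.withSteps st).state P n).Admissible ∧ ((r.withSteps st).state P n).Defined (st n) := by
  have hdef : ∀ n, ((r.withSteps st).state P n).Admissible →
      ((r.withSteps st).state P n).Defined (st n) := by
    intro n hn
    rcases lt_or_ge n L with h | h
    · exact hst.defined n h
    · exact hn.defined_of_eq_empty (hst.eq_empty n h)
  have hadm : ((r.withSteps st).state P n).Admissible := by
    induction n with
    | zero => exact hr.admissible hP
    | succ n ih => exact ih.step (hdef n ih)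
  exact ⟨hadm, hdef n hadm⟩

theorem ValidSteps.isBranch {r : FoldSeq F} {P : (∀ i, F i) → ℝ} {st : ℕ → FoldStep Λ} {L : ℕ}
    (hst : r.ValidSteps P st L) (hr : r.RootDefined P) (hP : ∀ ω, 0 ≤ P ω) :
    (r.withSteps st).IsBranch P where
  beta_ne := hr.beta_ne
  subset n := by
    change (st n).1 ⊆ _
    rcases lt_or_ge n L with h | h
    · exact hst.subset n h
    · rw [hst.eq_empty n h]
      exact Finset.empty_subset _
  defined_zero := hr.defined_zero
  defined_succ n := (hst.defined_all hr hP n).2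

/-- The empty step at position `L` is replaced by `k`; the states up to `L` depend on earlier steps
only and do not change. -/
theorem ValidSteps.update {r : FoldSeq F} {P : (∀ i, F i) → ℝ} {st : ℕ → FoldStep Λ} {L : ℕ}
    (hst : r.ValidSteps P st L) {k : FoldStep Λ} (hne : k.1.Nonempty)
    (hsub : k.1 ⊆ ((r.withSteps st).state P L).1)
    (hdef : ((r.withSteps st).state P L).Defined k) :
    r.ValidSteps P (Function.update st L k) (L + 1) := by
  have hstate : ∀ n, n ≤ L →
      (r.withSteps (Function.update st L k)).state P n = (r.withSteps st).state P n := by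
    intro n hn
    exact withSteps_state_congr r P fun j hj =>
      Function.update_of_ne (hj.trans_le hn).ne _ _
  refine ⟨fun n hn => ?_, fun n hn => ?_, fun n hn => ?_, fun n hn => ?_⟩
  · rcases (Nat.lt_succ_iff.1 hn).lt_or_eq with h | rfl
    · rw [Function.update_of_ne h.ne]
      exact hst.nonempty n h
    · rwa [Function.update_self]
  · rw [hstate n (Nat.lt_succ_iff.1 hn)]
    rcases (Nat.lt_succ_iff.1 hn).lt_or_eq with h | rfl
    · rw [Function.update_of_ne h.ne]
      exact hst.subset n h
    · rwa [Function.update_self]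
  · rw [hstate n (Nat.lt_succ_iff.1 hn)]
    rcases (Nat.lt_succ_iff.1 hn).lt_or_eq with h | rfl
    · rw [Function.update_of_ne h.ne]
      exact hst.defined n h
    · rwa [Function.update_self]
  · rw [Function.update_of_ne (by omega)]
    exact hst.eq_empty n (by omega)

/-- Strong induction on the number of remaining sites, over all continuations of the branch. A
further folding with non-empty `K` gives a longer valid sequence on fewer sites, and the all-empty
continuation is an infinite branch whose limit has the assumed representation. -/
theorem negCorrelated_state {B : Finset (Finset Λ)} {P : (∀ i, F i) → ℝ} (hP : ∀ ω, 0 ≤ P ω)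
    (hRCR : HasRCRAtInfinity B P fun _ ν =>
      IsAntiferromagnetic ν ∧ IsSymmetric ν ∧ OnIsolatedEdges ν)
    {r : FoldSeq F} (hr : r.RootDefined P) {st : ℕ → FoldStep Λ} {L : ℕ}
    (hst : r.ValidSteps P st L) : ((r.withSteps st).state P L).NegCorrelated := by
  induction hn : ((r.withSteps st).state P L).1.card using Nat.strong_induction_on
    generalizing st L with
  | _ n ih =>
    subst hn
    have hadm := (hst.defined_all hr hP L).1
    obtain ⟨Q, hQ, hQ'⟩ := (r.withSteps st).exists_isLimit P (L := L) hst.eq_empty hadm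
    refine hadm.negCorrelated (fun k hsub hne hdef => ?_) Q hQ' fun N f g hf hg => ?_
    · have hval := hst.update hne hsub hdef
      have hstate : (r.withSteps (Function.update st L k)).state P (L + 1) =
          ((r.withSteps st).state P L).step k := by
        rw [withSteps_state_succ, Function.update_self]
        congr 1
        exact withSteps_state_congr r P fun j hj => Function.update_of_ne hj.ne _ _
      have := ih _ ?_ hval rfl
      · rwa [hstate] at this
      · rw [hstate]
        exact Finset.card_lt_card (Finset.sdiff_ssubset hsub hne)
    · obtain ⟨ν, hν, hanti, -, hiso⟩ := hRCR (r.withSteps st) L (hst.isBranch hr hP)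
        ⟨hst.nonempty, hst.eq_empty⟩ Q hQ
      exact hν.sum_mul_mul_nonpos hanti hiso hf hg

end FoldSeq

/-! ### Negative association -/

theorem sum_mul_sum_of_hasRCRAtInfinity {Λ : Type*} [Fintype Λ] [DecidableEq Λ] {F : Λ → Type*}
    [∀ i, Fintype (F i)] [∀ i, LinearOrder (F i)] {B : Finset (Finset Λ)} {P : (∀ i, F i) → ℝ}
    (hP : IsProb P)
    (hRCR : HasRCRAtInfinity B P fun _ ν =>
      IsAntiferromagnetic ν ∧ IsSymmetric ν ∧ OnIsolatedEdges ν)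
    {N : Set Λ} {f g : (∀ i, F i) → ℝ} (hf : Monotone f) (hg : Monotone g) (hfN : DependsOn f N)
    (hgN : DependsOn g Nᶜ) :
    ∑ ω, P ω * (f ω * g ω) ≤ (∑ ω, P ω * f ω) * ∑ ω, P ω * g ω := by
  let e : Conf F (Finset.univ : Finset Λ) → ∀ i, F i := fun ω i => ω ⟨i, Finset.mem_univ i⟩
  have he : ∀ k : (∀ i, F i) → ℝ, ∑ ω, k (e ω) = ∑ ω, k ω := by
    intro k
    refine Finset.sum_bij' (fun ω _ => e ω) (fun ω _ i => ω i.1) ?_ ?_ ?_ ?_ ?_ <;> simp [e]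
  have hmono : ∀ k : (∀ i, F i) → ℝ, Monotone k → Monotone fun ω => k (e ω) :=
    fun k hk ω ω' h => hk fun i => h ⟨i, Finset.mem_univ i⟩
  have hdep : ∀ (k : (∀ i, F i) → ℝ) (M : Set Λ), DependsOn k M →
      DependsOn (fun ω => k (e ω)) {i | i.1 ∈ M} :=
    fun k M hk ω ω' h => hk fun i hi => h ⟨i, Finset.mem_univ i⟩ hi
  have key := sum_covTerm_nonpos (fun ω => P (e ω)) (fun ω => f (e ω)) (fun ω => g (e ω)) ?_
  · rw [sum_covTerm, he P, he fun ω => P ω * (f ω * g ω), he fun ω => P ω * f ω,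
      he fun ω => P ω * g ω, hP.sum_eq_one] at key
    linarith
  intro K hK α β₁ β₂ hβ
  -- Only the first folding of `r` matters: `withSteps` overwrites the rest, here by empty steps, so
  -- the result is used with `L = 0` and power `2 ^ 0`.
  let r : FoldSeq F := ⟨fun _ => K, α, fun _ _ => false, β₁, β₂⟩
  by_cases hr : ∃ ω, foldWeight (M := Finset.univ) (fun ω => P (e ω)) K α β₁ β₂ ω ≠ 0
  · have hroot : r.RootDefined P := ⟨hβ, hr⟩
    have hval : r.ValidSteps P (fun _ => ⟨∅, fun _ => false⟩) 0 :=
      ⟨by simp, by simp, by simp, by simp⟩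
    have hcor := FoldSeq.negCorrelated_state hP.nonneg hRCR hroot hval 0 N _ _
      (oddMono_foldFun α β₁ β₂ (hmono f hf) (hdep f N hfN))
      (oddMono_foldFun (N := Nᶜ) α β₁ β₂ (hmono g hg) (hdep g Nᶜ hgN))
    have hZ := hroot.sum_pos hP.nonneg
    refine le_of_eq_of_le ?_ (mul_nonpos_of_nonneg_of_nonpos hZ.le hcor)
    rw [Finset.mul_sum]
    refine Finset.sum_congr rfl fun ξ _ => ?_
    rw [pow_zero, pow_one]
    have h0 : ((r.withSteps fun _ => ⟨∅, fun _ => false⟩).state P 0).2 ξ = _ :=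
      FoldSeq.node_zero r P hβ ξ
    rw [h0, div_mul_eq_mul_div, mul_div_cancel₀ _ hZ.ne']
  · push Not at hr
    refine (Finset.sum_eq_zero fun ξ _ => ?_).le
    have h0 := hr (relabel β₁ β₂ ξ)
    rw [foldWeight_relabel _ _ _ _ hβ] at h0
    rw [h0, zero_mul]

/-! ### From increasing functions to increasing events -/

theorem indicator_one_mono {X : Type*} [Preorder X] {A : Set X} (hA : IsUpperSet A) :
    Monotone (A.indicator (1 : X → ℝ)) := by
  intro x y hxy
  by_cases hx : x ∈ A
  · rw [Set.indicator_of_mem hx, Set.indicator_of_mem (hA hxy hx)]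
    rfl
  · rw [Set.indicator_of_notMem hx]
    exact Set.indicator_nonneg (fun _ _ => zero_le_one) _

section Kernel

variable {Λ : Type*} {F : Λ → Type*}

/-- The configurations whose restriction to `N` ensures `A`. -/
def cylinderKernel (A : Set (∀ i, F i)) (N : Set Λ) : Set (∀ i, F i) :=
  {ω | cylinder ω N ⊆ A}

theorem cylinderKernel_subset (A : Set (∀ i, F i)) (N : Set Λ) : cylinderKernel A N ⊆ A :=
  fun _ h => h fun _ _ => rfl

theorem isUpperSet_cylinderKernel [∀ i, LinearOrder (F i)] {A : Set (∀ i, F i)}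
    (hA : IsUpperSet A) (N : Set Λ) : IsUpperSet (cylinderKernel A N) := by
  classical
  intro ω ω' h hω ζ hζ
  -- The splice of `ω` on `N` with `ζ` elsewhere lies in the cylinder of `ω`, hence in `A`, and
  -- below `ζ`.
  have hmem : (fun i => if i ∈ N then ω i else ζ i) ∈ A := hω fun i hi => if_pos hi
  refine hA (fun i => ?_) hmem
  split_ifs with hi
  · rw [hζ i hi]
    exact h i
  · exact le_rfl

theorem dependsOn_indicator_cylinderKernel (A : Set (∀ i, F i)) (N : Set Λ) :
    DependsOn ((cylinderKernel A N).indicator (1 : (∀ i, F i) → ℝ)) N := by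
  intro ω ω' h
  have hc : cylinder ω N = cylinder ω' N :=
    Set.ext fun ζ => forall₂_congr fun i hi => by rw [h i hi]
  have : ω ∈ cylinderKernel A N ↔ ω' ∈ cylinderKernel A N := by
    simp only [cylinderKernel, Set.mem_ofPred_eq, hc]
  by_cases hω : ω ∈ cylinderKernel A N
  · rw [Set.indicator_of_mem hω, Set.indicator_of_mem (this.1 hω)]
    rfl
  · rw [Set.indicator_of_notMem hω, Set.indicator_of_notMem (mt this.2 hω)]

end Kernel

theorem prob_eq_sum {X : Type*} [Fintype X] (p : X → ℝ) (A : Set X) :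
    prob p A = ∑ x, p x * A.indicator (1 : X → ℝ) x := by
  refine Finset.sum_congr rfl fun x _ => ?_
  by_cases hx : x ∈ A <;> simp [hx]

theorem prob_mono {X : Type*} [Fintype X] {p : X → ℝ} (hp : ∀ x, 0 ≤ p x) {A B : Set X}
    (h : A ⊆ B) : prob p A ≤ prob p B :=
  Finset.sum_le_sum fun x _ => Set.indicator_le_indicator_of_subset h hp x

theorem prob_nonneg {X : Type*} [Fintype X] {p : X → ℝ} (hp : ∀ x, 0 ≤ p x) (A : Set X) :
    0 ≤ prob p A :=
  Finset.sum_nonneg fun x _ => Set.indicator_nonneg (fun y _ => hp y) x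

end FoldRCR

theorem theorem5p4p3 {Λ : Type*} [Fintype Λ] [DecidableEq Λ] {F : Λ → Type*}
    [∀ i, Fintype (F i)] [∀ i, LinearOrder (F i)]
    (B : Finset (Finset Λ)) (P : (∀ i, F i) → ℝ) (hP : FoldRCR.IsProb P)
    (hRCR : FoldRCR.HasRCRAtInfinity B P fun _ ν =>
      FoldRCR.IsAntiferromagnetic ν ∧ FoldRCR.IsSymmetric ν ∧ FoldRCR.OnIsolatedEdges ν) :
    FoldRCR.NegativelyAssociated P := by
  open FoldRCR in
  intro A C hA hC hAC
  obtain ⟨N, hN⟩ := hAC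
  -- Disjointness of supports enters here only: on `A ∩ C` both events are already ensured by
  -- complementary sets of sites, so each may be replaced by its smaller kernel.
  have hsub : A ∩ C ⊆ cylinderKernel A N ∩ cylinderKernel C Nᶜ := fun ω hω => hN ω hω
  have key := sum_mul_sum_of_hasRCRAtInfinity hP hRCR
    (indicator_one_mono (isUpperSet_cylinderKernel hA N))
    (indicator_one_mono (isUpperSet_cylinderKernel hC Nᶜ))
    (dependsOn_indicator_cylinderKernel A N) (dependsOn_indicator_cylinderKernel C Nᶜ)
  calc prob P (A ∩ C) ≤ prob P (cylinderKernel A N ∩ cylinderKernel C Nᶜ) :=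
        prob_mono hP.nonneg hsub
    _ = ∑ ω, P ω * ((cylinderKernel A N).indicator 1 ω * (cylinderKernel C Nᶜ).indicator 1 ω) := by
        rw [prob_eq_sum]
        simp only [Set.inter_indicator_one, Pi.mul_apply]
    _ ≤ prob P (cylinderKernel A N) * prob P (cylinderKernel C Nᶜ) := by
        rw [prob_eq_sum, prob_eq_sum]
        exact key
    _ ≤ prob P A * prob P C :=
        mul_le_mul (prob_mono hP.nonneg (cylinderKernel_subset A N))
          (prob_mono hP.nonneg (cylinderKernel_subset C Nᶜ)) (prob_nonneg hP.nonneg _)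
          (prob_nonneg hP.nonneg _)
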